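/- **Setting.** Let $p\ge 1$ (the order). A knot grid is a strictly increasing family of real knots indexed by an interval of integers (for instance $\{0,\dots,n-1\}$, or $\mathbb Z$). Let $(x_{j+1,l})$ be a fine and $(x_{j,k})$ a coarse knot grid that are two-nested: whenever $k$ is a coarse index, $2k$ is a fine index and $x_{j+1,2k}=x_{j,k}$. (Values given to knots outside the index range, e.g. repeated end knots, play no role.) On either grid, with knots $x_i$ (scale index omitted), the B-splines of order $1$ are $\varphi^{[1]}_k=\chi_{[x_k,x_{k+1})}$, and for $p\ge2$ $$\varphi^{[p]}_k(x)=\frac{x-x_{k-\lfloor p/2\rfloor}}{x_{k+\lceil p/2\rceil-1}-x_{k-\lfloor p/2\rfloor}}\varphi^{[p-1]}_{k-1+(p\bmod 2)}(x)+\frac{x_{k+\lceil p/2\rceil}-x}{x_{k+\lceil p/2\rceil}-x_{k-\lfloor p/2\rfloor+1}}\varphi^{[p-1]}_{k+(p\bmod 2)}(x).$$ Put $l_k=k-\lfloor p/2\rfloor$, $r_k=k+\lceil p/2\rceil$. An index $k$ is *inner* if $l_k$ and $r_k$ are indices of the grid. The *interior interval* $I$ is the union of the intervals $[x_i,x_{i+1})$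 such that $i-p+1$ and $i+p$ are indices of the grid (it is $[x_{p-1},x_{n-p})$ for the index set $\{0,\dots,n-1\}$). For $0\le q<p$, *power coefficients* are numbers $\tilde x^{[p,q]}_{k}$ with $x^q=\sum_{k\text{ inner}}\tilde x^{[p,q]}_{k}\varphi^{[p]}_{k}(x)$ for all $x\in I$. **The scheme.** Let $u=\lfloor (p+1)/4\rfloor$, $r=\lceil p/2\rceil-2u\in\{0,1\}$, $\tilde r=p-2\lfloor p/2\rfloor$, and for $1-r\le s\le u$ put $m=u-s$, $t=r+2s-1$. Let $\tilde u=\tilde r$ if $r=0$ and $s=1$, and $\tilde u=2\tilde r$ otherwise; let $\tilde t=\tilde r$ if $s=0$, and $\tilde t=2\tilde r$ otherwise. Write $y_l=x_{j+1,l}$ and $$\Delta^U_k=y_{2k+2m+2t}-y_{2k-2m-2t+\tilde u},\qquad \Delta^P_k=y_{2k+2m+2t+2}-y_{2k-2m-2t+\tilde t}.$$ Factors: $c^{[0]}_{l}=1$, $$c^{[s]}_{2k}=c^{[s-1]}_{2k}\,\frac{y_{2k+2m+1}-y_{2k-2m-1}}{\Delta^U_k}\ (1\le s\le u),\qquad c^{[r+s]}_{2k+1}=c^{[r+s-1]}_{2k+1}\,\frac{y_{2k+2m+1}-y_{2k-2m+1}}{\Delta^P_k}\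 (1-r\le s\le u).$$ Lower bidiagonal update matrices $U^{[s]}_j$, $1\le s\le u$: $$U^{[s]}_{k,k}=-\frac{c^{[s-1]}_{2k}}{c^{[r+s-1]}_{2k+1}}\cdot\frac{y_{2k-2m-1}-y_{2k-2m-2t+\tilde u}}{\Delta^U_k},\qquad U^{[s]}_{k,k-1}=-\frac{c^{[s-1]}_{2k}}{c^{[r+s-1]}_{2k-1}}\cdot\frac{y_{2k+2m+2t}-y_{2k+2m+1}}{\Delta^U_k}.$$ Upper bidiagonal prediction matrices $P^{[r+s]}_j$, $1-r\le s\le u$: $$P^{[r+s]}_{k,k}=\frac{c^{[r+s-1]}_{2k+1}}{c^{[s]}_{2k}}\cdot\frac{y_{2k+2m+2t+2}-y_{2k+2m+1}}{\Delta^P_k},\qquad P^{[r+s]}_{k,k+1}=\frac{c^{[r+s-1]}_{2k+1}}{c^{[s]}_{2k+2}}\cdot\frac{y_{2k-2m+1}-y_{2k-2m-2t+\tilde t}}{\Delta^P_k}.$$ Starting from $s^{[0]}_{j+1,l}=s_{j+1,l}$, first, if $r=1$, perform the prediction step with $s=0$; then for $s=1,\dots,u$ perform the update step $s$ followed by the prediction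 step $r+s$, where $$s^{[s]}_{j+1,2k}=s^{[s-1]}_{j+1,2k}+U^{[s]}_{k,k}s^{[r+s-1]}_{j+1,2k+1}+U^{[s]}_{k,k-1}s^{[r+s-1]}_{j+1,2k-1},$$ $$s^{[r+s]}_{j+1,2k+1}=s^{[r+s-1]}_{j+1,2k+1}-P^{[r+s]}_{k,k}s^{[s]}_{j+1,2k}-P^{[r+s]}_{k,k+1}s^{[s]}_{j+1,2k+2}.$$ Finally $D_j=\operatorname{diag}(c^{[u]}_{2k})$, $s_{j,k}=D_{j,k,k}^{-1}s^{[u]}_{j+1,2k}$ and $d_{j,k}=s^{[r+u]}_{j+1,2k+1}$. The refinement matrix $H_j$ is the matrix whose $k$-th column is the output $(s_{j+1,l})_l$ of the inverse scheme for $s_j$ the $k$-th unit vector and $d_j=0$. **Proposition (lifting scheme for B-splines).** 1. Power coefficients exist on the fine grid for every $0\le q<p$. For every inner coarse index $k$, $c^{[s]}_{2k}\ne0$ for all $0\le s\le u$, and if $k+1$ is inner too, $c^{[i]}_{2k+1}\neq 0$ for all $0\le i<r+u$. 2. For every $0\le q<p$, if $s_{j+1,l}=\tilde x^{[p,q]}_{j+1,l}$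 are power coefficients on the fine grid, then the $s_{j,k}$ are power coefficients $\tilde x^{[p,q]}_{j,k}$ on the coarse grid; if the interior interval $I_j$ of the coarse grid is nonempty, they agree at all inner $k$ with any power coefficients on the coarse grid. Moreover $d_{j,k}=0$ whenever $k$ and $k+1$ are inner. 3. Consequently the refinement equation of the scheme has the B-splines as solution: for every inner coarse index $k$ and all $x\in\mathbb R$, $$\varphi^{[p]}_{j,k}(x)=\sum_{l}H_{j,l,k}\,\varphi^{[p]}_{j+1,l}(x).$$ 4. This solution is unique in the following sense. Let $F_l,f_k:\mathbb R\to\mathbb R$ be functions such that, on the coarse interior interval $I_j$: $F_l$ vanishes outside $[x_{j+1,l_l},x_{j+1,r_l})$ for all inner fine $l$; $x^q=\sum_{l\text{ inner}}\tilde x^{[p,q]}_{j+1,l}F_l(x)$ for all $0\le q<p$ and all fine power coefficients; and $f_k=\sum_l H_{j,l,k}F_l$ for all inner coarse $k$. Then $f_k=\varphi^{[p]}_{j,k}$ on $I_j$ for all inner coarse $k$. If the grids are indexed by $\mathbb Z$, all indices are inner. -/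

import Mathlib

noncomputable section

namespace BSplineLifting

/-! ### Knot grids, B-splines and power coefficients -/

/-- A grid of strictly increasing knots `knot k`, `k ∈ idx`, where `idx` is an interval of integers:
`{0, …, n - 1}` for a finite grid, or a half-infinite or bi-infinite interval.  The values of `knot`
outside `idx` are arbitrary (for instance repeated end knots) and nothing below depends on them. -/
structure KnotGrid where
  idx : Set ℤ
  ordConnected : idx.OrdConnected
  knot : ℤ → ℝ
  strictMonoOn : StrictMonoOn knot idx

/-- `fine` is a binary refinement of `coarse`: `x_{j+1,2k} = x_{j,k}`. -/
def TwoNested (fine coarse : KnotGrid) : Prop :=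
  ∀ k ∈ coarse.idx, 2 * k ∈ fine.idx ∧ fine.knot (2 * k) = coarse.knot k

/-- `bspline x p k` is the B-spline of order `p` (degree `p - 1`) with index `k` on the knots `x`; it
lives on `[x (k - ⌊p/2⌋), x (k + ⌈p/2⌉))`.  Order `0` is not used.
In the recursion the order is `p + 2`, so `(p + 2) / 2 = ⌊(p+2)/2⌋`, `(p + 3) / 2 = ⌈(p+2)/2⌉`, and
`(p + 2) % 2` is the remainder. -/
def bspline (x : ℤ → ℝ) : ℕ → ℤ → ℝ → ℝ
  | 0, _, _ => 0
  | 1, k, t => (Set.Ico (x k) (x (k + 1))).indicator 1 t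
  | p + 2, k, t =>
      let fl : ℤ := ((p + 2) / 2 : ℕ)
      let ce : ℤ := ((p + 3) / 2 : ℕ)
      let re : ℤ := ((p + 2) % 2 : ℕ)
      (t - x (k - fl)) / (x (k + ce - 1) - x (k - fl)) * bspline x (p + 1) (k - 1 + re) t
        + (x (k + ce) - t) / (x (k + ce) - x (k - fl + 1)) * bspline x (p + 1) (k + re) t

/-- `l_k = k - ⌊p/2⌋`. -/
def leftIdx (p : ℕ) (k : ℤ) : ℤ := k - (p / 2 : ℕ)

/-- `r_k = k + ⌈p/2⌉`. -/
def rightIdx (p : ℕ) (k : ℤ) : ℤ := k + ((p + 1) / 2 : ℕ)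

namespace KnotGrid

/-- The indices of the B-splines of order `p` all of whose knots belong to the grid.
For `idx = {0, …, n - 1}` this is `{⌊p/2⌋, …, n - 1 - ⌈p/2⌉}`. -/
def inner (G : KnotGrid) (p : ℕ) : Set ℤ :=
  {k | leftIdx p k ∈ G.idx ∧ rightIdx p k ∈ G.idx}

/-- The interior interval: the union of the knot intervals `[x_i, x_{i+1})` on which only B-splines
with index in `inner` are nonzero.  For `idx = {0, …, n - 1}` this is `[x_{p-1}, x_{n-p})`. -/
def interior (G : KnotGrid) (p : ℕ) : Set ℝ :=
  {t | ∃ i : ℤ, i - p + 1 ∈ G.idx ∧ i + p ∈ G.idx ∧ G.knot i ≤ t ∧ t < G.knot (i + 1)}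

/-- The interval `[x_{l_k}, x_{r_k})` on which the B-spline with index `k` lives. -/
def supp (G : KnotGrid) (p : ℕ) (k : ℤ) : Set ℝ :=
  Set.Ico (G.knot (leftIdx p k)) (G.knot (rightIdx p k))

end KnotGrid

/-- `a` is a family of power coefficients `x̃_k^{[p,q]}`: the coefficients of the power function `t ^ q`
in the B-splines of order `p`, on the interior interval. -/
def IsPowerCoeffs (G : KnotGrid) (p q : ℕ) (a : ℤ → ℝ) : Prop :=
  ∀ t ∈ G.interior p, ∑ᶠ k ∈ G.inner p, a k * bspline G.knot p k t = t ^ q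

/-! ### Parameters of the lifting scheme -/

/-- The number of update steps, `u = ⌊(p + 1) / 4⌋`. -/
def numU (p : ℕ) : ℕ := (p + 1) / 4

/-- `r = ⌈p/2⌉ - 2u ∈ {0, 1}`; there are `u + r` prediction steps. -/
def numR (p : ℕ) : ℕ := (p + 1) / 2 - 2 * numU p

/-- The parity `r̃` of `p`. -/
def par (p : ℕ) : ℤ := (p % 2 : ℕ)

/-- `m = u - s`. -/
def mIdx (p s : ℕ) : ℤ := (numU p : ℤ) - s

/-- `t = r + 2s - 1`. -/
def tIdx (p s : ℕ) : ℤ := (numR p : ℤ) + 2 * s - 1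

/-- The shift `ũ` in the update step `s`: for odd `p` it is `1` if this is the very first lifting step
of the scheme and `2` otherwise; for even `p` it is `0`. -/
def shiftU (p s : ℕ) : ℤ := if numR p = 0 ∧ s = 1 then par p else 2 * par p

/-- The shift `t̃` in the prediction step `r + s`: for odd `p` it is `1` if this is the very first
lifting step of the scheme (`s = 0`) and `2` otherwise; for even `p` it is `0`. -/
def shiftP (p s : ℕ) : ℤ := if s = 0 then par p else 2 * par p

/-- The difference of the two knots that the update step `s` brings in at the even index `2k`. -/
def denU (x : ℤ → ℝ) (p s : ℕ) (k : ℤ) : ℝ :=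
  x (2 * k + 2 * mIdx p s + 2 * tIdx p s) - x (2 * k - 2 * mIdx p s - 2 * tIdx p s + shiftU p s)

/-- The difference of the two knots that the prediction step `r + s` brings in at the odd index
`2k + 1`. -/
def denP (x : ℤ → ℝ) (p s : ℕ) (k : ℤ) : ℝ :=
  x (2 * k + 2 * mIdx p s + 2 * tIdx p s + 2)
    - x (2 * k - 2 * mIdx p s - 2 * tIdx p s + shiftP p s)

/-- The even factor `c_{j+1,2k}^{[s]}`; `x` are the fine knots. -/
def evenFactor (x : ℤ → ℝ) (p : ℕ) : ℕ → ℤ → ℝ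
  | 0, _ => 1
  | s + 1, k => evenFactor x p s k *
      ((x (2 * k + 2 * mIdx p (s + 1) + 1) - x (2 * k - 2 * mIdx p (s + 1) - 1))
        / denU x p (s + 1) k)

/-- The odd factor `c_{j+1,2k+1}^{[i]}`, where `i = r + s`, so `s = i - r`. -/
def oddFactor (x : ℤ → ℝ) (p : ℕ) : ℕ → ℤ → ℝ
  | 0, _ => 1
  | i + 1, k =>
      let s := i + 1 - numR p
      oddFactor x p i k *
        ((x (2 * k + 2 * mIdx p s + 1) - x (2 * k - 2 * mIdx p s + 1)) / denP x p s k)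

/-- The lower bidiagonal update matrix `U_j^{[s]}`, `1 ≤ s ≤ u`. -/
def updateMatrix (x : ℤ → ℝ) (p s : ℕ) : Matrix ℤ ℤ ℝ := fun k l =>
  if l = k then
    -(evenFactor x p (s - 1) k / oddFactor x p (numR p + s - 1) k) *
      ((x (2 * k - 2 * mIdx p s - 1) - x (2 * k - 2 * mIdx p s - 2 * tIdx p s + shiftU p s))
        / denU x p s k)
  else if l = k - 1 then
    -(evenFactor x p (s - 1) k / oddFactor x p (numR p + s - 1) (k - 1)) *
      ((x (2 * k + 2 * mIdx p s + 2 * tIdx p s) - x (2 * k + 2 * mIdx p s + 1)) / denU x p s k)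
  else 0

/-- The upper bidiagonal prediction matrix `P_j^{[r+s]}`, `1 - r ≤ s ≤ u`. -/
def predictMatrix (x : ℤ → ℝ) (p s : ℕ) : Matrix ℤ ℤ ℝ := fun k l =>
  if l = k then
    oddFactor x p (numR p + s - 1) k / evenFactor x p s k *
      ((x (2 * k + 2 * mIdx p s + 2 * tIdx p s + 2) - x (2 * k + 2 * mIdx p s + 1))
        / denP x p s k)
  else if l = k + 1 then
    oddFactor x p (numR p + s - 1) k / evenFactor x p s (k + 1) *
      ((x (2 * k - 2 * mIdx p s + 1) - x (2 * k - 2 * mIdx p s - 2 * tIdx p s + shiftP p s))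
        / denP x p s k)
  else 0

/-- The diagonal rescaling matrix `D_j`. -/
def scaleMatrix (x : ℤ → ℝ) (p : ℕ) : Matrix ℤ ℤ ℝ :=
  Matrix.diagonal (evenFactor x p (numU p))

/-- Product of a matrix with finitely supported rows and a vector. -/
def mulV (A : Matrix ℤ ℤ ℝ) (v : ℤ → ℝ) : ℤ → ℝ := fun k => ∑ᶠ l, A k l * v l

/-! ### The forward transform -/

/-- `lift x p a s` is the pair of lifted even coefficients `s_{j+1,2k}^{[s]}` and lifted odd
coefficients `s_{j+1,2k+1}^{[r+s]}`, starting from the fine coefficients `a`.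
If `r = 1`, the scheme opens with the prediction step number `1` (the case `s = 0`); then the update
step `s` and the prediction step `r + s` follow for `s = 1, 2, …`. -/
def lift (x : ℤ → ℝ) (p : ℕ) (a : ℤ → ℝ) : ℕ → (ℤ → ℝ) × (ℤ → ℝ)
  | 0 =>
      let e : ℤ → ℝ := fun k => a (2 * k)
      let o : ℤ → ℝ := fun k => a (2 * k + 1)
      (e, if numR p = 1 then o - mulV (predictMatrix x p 0) e else o)
  | s + 1 =>
      let e := (lift x p a s).1 + mulV (updateMatrix x p (s + 1)) (lift x p a s).2
      (e, (lift x p a s).2 - mulV (predictMatrix x p (s + 1)) e)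

/-- The scaling coefficients `s_{j,k}` produced by the forward transform. -/
def coarseCoeff (x : ℤ → ℝ) (p : ℕ) (a : ℤ → ℝ) (k : ℤ) : ℝ :=
  (scaleMatrix x p k k)⁻¹ * (lift x p a (numU p)).1 k

/-- The detail coefficients `d_{j,k}` produced by the forward transform. -/
def detailCoeff (x : ℤ → ℝ) (p : ℕ) (a : ℤ → ℝ) (k : ℤ) : ℝ :=
  (lift x p a (numU p)).2 k

/-! ### The inverse transform and the refinement matrix -/

/-- Undo the lifting steps, from the update-prediction pair number `s` down to the first step. -/
def unlift (x : ℤ → ℝ) (p : ℕ) : ℕ → (ℤ → ℝ) → (ℤ → ℝ) → (ℤ → ℝ) × (ℤ → ℝ)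
  | 0, e, o => (e, if numR p = 1 then o + mulV (predictMatrix x p 0) e else o)
  | s + 1, e, o =>
      let o' := o + mulV (predictMatrix x p (s + 1)) e
      unlift x p s (e - mulV (updateMatrix x p (s + 1)) o') o'

/-- The inverse transform: fine coefficients from scaling coefficients `c` and details `d`. -/
def synthesis (x : ℤ → ℝ) (p : ℕ) (c d : ℤ → ℝ) (l : ℤ) : ℝ :=
  let w := unlift x p (numU p) (mulV (scaleMatrix x p) c) d
  if Even l then w.1 (l / 2) else w.2 (l / 2)

/-- The refinement matrix `H_j` of the scheme.  Its column `k` is the inverse transform of the `k`-th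
unit vector with zero details, that is, `H_j` is the product of the inverse lifting steps with
`[D_j; 0]`. -/
def refinementMatrix (x : ℤ → ℝ) (p : ℕ) : Matrix ℤ ℤ ℝ := fun l k =>
  synthesis x p (Pi.single k 1) 0 l

end BSplineLifting

end

open BSplineLifting

namespace BSplineLifting

open Polynomial

/-! ### The Cox–de Boor recursion and Marsden's identity -/

/-! Marsden's identity expands `(t - X) ^ n`, with `n = p - 1`, in the B-splines. The coefficient of
a B-spline is its dual polynomial, the product of `x l - X` over its interior knots. A linear
functional `L` on polynomials that sends `(t - X) ^ n` to `t ^ q` therefore turns dual polynomials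
into power coefficients (`marsden`, `powerFunctional_pow`). On a single knot interval the matrix of
power coefficients times the collocation matrix of the B-splines is a transposed Vandermonde matrix,
so both factors are invertible. Hence power coefficients are unique, and the values of the B-splines
are determined by the power coefficients (`KnotGrid.eq_powerCoeff`, `KnotGrid.eq_bspline`).

Lifting acts on dual polynomials by exchanging knots. If the fine coefficients are `L` of dual
polynomials, each intermediate coefficient is a factor `c` times `L` of a product over an explicit
set of knots (`evenSet`, `oddSet`). A lifting step takes odd knots out and brings even knots in, by
a linear relation between products of one or two linear polynomials (`knotPoly_exchange_one`,
`knotPoly_exchange_two`). At the end the even coefficients involve only even knots and are the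
coarse coefficients. In the last prediction the two knots to be removed coincide, so the details
vanish (`lift_eq`, `coarseCoeff_eq`, `detailCoeff_eq_zero`).

For a bi-infinite grid, inverting the scheme shows that the refinement matrix `H` maps coarse power
coefficients to fine ones. The combinations of fine B-splines given by the columns of `H` then
reproduce all powers with the coarse power coefficients. They also have the right supports, so they
are the coarse B-splines (`refinement_of_strictMono`). A general grid reduces to this case, because
a column of `H` is finitely supported and depends only on knots inside the coarse support
(`refinementMatrix_congr`, `extendKnots`). For uniqueness, the same local invertibility forces the
`F l` that enter to be fine B-splines, and the refinement equation gives the rest. -/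

/-- The B-spline of degree `n` on the knots `x j, …, x (j + n + 1)`, indexed by its left knot. -/
noncomputable def coxDeBoor (x : ℤ → ℝ) : ℕ → ℤ → ℝ → ℝ
  | 0, j, t => (Set.Ico (x j) (x (j + 1))).indicator 1 t
  | n + 1, j, t =>
      (t - x j) / (x (j + n + 1) - x j) * coxDeBoor x n j t
        + (x (j + n + 2) - t) / (x (j + n + 2) - x (j + 1)) * coxDeBoor x n (j + 1) t

/-- Indexing by the left knot absorbs the floors and ceilings: for either parity of the order, the
two terms of the recursion start at the knots `j` and `j + 1`. -/
theorem bspline_eq_coxDeBoor (x : ℤ → ℝ) (n : ℕ) (k : ℤ) (t : ℝ) :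
    bspline x (n + 1) k t = coxDeBoor x n (leftIdx (n + 1) k) t := by
  induction n generalizing k with
  | zero => simp [bspline, coxDeBoor, leftIdx]
  | succ n ih =>
    have h1 : k - 1 + ((n + 2) % 2 : ℕ) - ((n + 1) / 2 : ℕ) = k - ((n + 2) / 2 : ℕ) := by omega
    have h2 : k + ((n + 2) % 2 : ℕ) - ((n + 1) / 2 : ℕ) = k - ((n + 2) / 2 : ℕ) + 1 := by omega
    have h3 : k + ((n + 3) / 2 : ℕ) - 1 = k - ((n + 2) / 2 : ℕ) + n + 1 := by omega
    have h4 : k + ((n + 3) / 2 : ℕ) = k - ((n + 2) / 2 : ℕ) + n + 2 := by omega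
    simp only [bspline, coxDeBoor, ih, leftIdx, h1, h2, h3]
    rw [h4]

theorem coxDeBoor_eq_zero {x : ℤ → ℝ} {n : ℕ} {j : ℤ} {t : ℝ}
    (hx : StrictMonoOn x (Set.Icc j (j + n + 1)))
    (ht : t ∉ Set.Ico (x j) (x (j + n + 1))) : coxDeBoor x n j t = 0 := by
  induction n generalizing j with
  | zero => simpa [coxDeBoor] using ht
  | succ n ih =>
    have hl : x j < x (j + 1) := hx ⟨by omega, by omega⟩ ⟨by omega, by omega⟩ (by omega)
    have hr : x (j + n + 1) < x (j + n + 2) :=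
      hx ⟨by omega, by omega⟩ ⟨by omega, by omega⟩ (by omega)
    have e : j + ((n + 1 : ℕ) : ℤ) + 1 = j + n + 2 := by omega
    have e' : j + 1 + (n : ℤ) + 1 = j + n + 2 := by omega
    rw [e] at ht
    simp only [coxDeBoor]
    rw [ih (hx.mono (Set.Icc_subset_Icc (by omega) (by omega))),
      ih (hx.mono (Set.Icc_subset_Icc (by omega) (by omega)))]
    · simp
    · rw [e']
      exact fun h => ht ⟨hl.le.trans h.1, h.2⟩
    · exact fun h => ht ⟨h.1, h.2.trans hr⟩

theorem coxDeBoor_congr {x y : ℤ → ℝ} {n : ℕ} {j : ℤ}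
    (h : ∀ i ∈ Set.Icc j (j + n + 1), x i = y i) (t : ℝ) :
    coxDeBoor x n j t = coxDeBoor y n j t := by
  induction n generalizing j with
  | zero => simp [coxDeBoor, h j (by simp), h (j + 1) (by simp)]
  | succ n ih =>
    simp only [coxDeBoor]
    rw [ih fun i hi => h i ⟨by have := hi.1; omega, by have := hi.2; omega⟩,
      ih fun i hi => h i ⟨by have := hi.1; omega, by have := hi.2; omega⟩,
      h j ⟨by omega, by omega⟩, h (j + 1) ⟨by omega, by omega⟩,
      h (j + n + 1) ⟨by omega, by omega⟩, h (j + n + 2) ⟨by omega, by omega⟩]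

/-- The polynomial `∏ (x l - X)` over a finite set of knots. -/
noncomputable def knotPoly (x : ℤ → ℝ) (S : Finset ℤ) : ℝ[X] := ∏ l ∈ S, (C (x l) - X)

theorem knotPoly_insert (x : ℤ → ℝ) {S : Finset ℤ} {a : ℤ} (ha : a ∉ S) :
    knotPoly x (insert a S) = (C (x a) - X) * knotPoly x S := Finset.prod_insert ha

/-- Marsden's identity on one knot interval, by induction on the degree. It carries the coefficients
of all powers `t ^ q` at once. -/
theorem marsden {x : ℤ → ℝ} {n : ℕ} {i : ℤ} {t : ℝ}
    (hx : StrictMonoOn x (Set.Icc (i - n) (i + n + 1))) (ht : t ∈ Set.Ico (x i) (x (i + 1))) :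
    ∑ m ∈ Finset.range (n + 1),
      C (coxDeBoor x n (i - n + m) t) * knotPoly x (Finset.Ioc (i - n + m) (i - n + m + n))
      = (C t - X) ^ n := by
  induction n with
  | zero => simp [coxDeBoor, knotPoly, Set.indicator_of_mem ht]
  | succ n ih =>
    have hx' : StrictMonoOn x (Set.Icc (i - n) (i + n + 1)) :=
      hx.mono (Set.Icc_subset_Icc (by omega) (by omega))
    have hleft : coxDeBoor x n (i - n - 1) t = 0 := by
      refine coxDeBoor_eq_zero (hx.mono (Set.Icc_subset_Icc (by omega) (by omega))) fun h => ?_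
      have e : i - n - 1 + n + 1 = i := by omega
      rw [e] at h
      exact absurd h.2 (not_lt.mpr ht.1)
    have hright : coxDeBoor x n (i + 1) t = 0 :=
      coxDeBoor_eq_zero (hx.mono (Set.Icc_subset_Icc (by omega) (by omega)))
        fun h => absurd ht.2 (not_lt.mpr h.1)
    -- The two dual polynomials share the knots `j + 1, …, j + n`. The Cox–de Boor weights sum to
    -- `1` and average the two remaining knots to `t`, which leaves the factor `t - X`.
    have key : ∀ j : ℤ, i - n ≤ j → j ≤ i →
        C ((t - x j) / (x (j + n + 1) - x j)) * knotPoly x (Finset.Ioc j (j + n + 1))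
          + C ((x (j + n + 1) - t) / (x (j + n + 1) - x j)) *
            knotPoly x (Finset.Ioc (j - 1) (j + n))
          = (C t - X) * knotPoly x (Finset.Ioc j (j + n)) := by
      intro j h1 h2
      have hlt : x j < x (j + n + 1) := hx ⟨by omega, by omega⟩ ⟨by omega, by omega⟩ (by omega)
      have hne : x (j + n + 1) - x j ≠ 0 := (sub_pos.mpr hlt).ne'
      have e1 : Finset.Ioc j (j + n + 1) = insert (j + n + 1) (Finset.Ioc j (j + n)) := by
        ext l; simp only [Finset.mem_Ioc, Finset.mem_insert]; omega
      have e2 : Finset.Ioc (j - 1) (j + n) = insert j (Finset.Ioc j (j + n)) := by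
        ext l; simp only [Finset.mem_Ioc, Finset.mem_insert]; omega
      rw [e1, e2, knotPoly_insert x (by simp), knotPoly_insert x (by simp)]
      have c1 : C ((t - x j) / (x (j + n + 1) - x j)) * (C (x (j + n + 1)) - X)
          + C ((x (j + n + 1) - t) / (x (j + n + 1) - x j)) * (C (x j) - X) = (C t - X : ℝ[X]) := by
        have s1 : (t - x j) / (x (j + n + 1) - x j) * x (j + n + 1)
          + (x (j + n + 1) - t) / (x (j + n + 1) - x j) * x j = t := by field_simp; ring
        have s2 : (t - x j) / (x (j + n + 1) - x j)
          + (x (j + n + 1) - t) / (x (j + n + 1) - x j) = 1 := by field_simp; ring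
        calc _ = C ((t - x j) / (x (j + n + 1) - x j) * x (j + n + 1)
          + (x (j + n + 1) - t) / (x (j + n + 1) - x j) * x j) - C ((t - x j) / (x (j + n + 1) - x j)
          + (x (j + n + 1) - t) / (x (j + n + 1) - x j)) * X := by
              simp only [C_add, C_mul]; ring
          _ = _ := by rw [s1, s2]; simp
      rw [← c1]; ring
    rw [pow_succ', ← ih hx', Finset.mul_sum]
    -- Each B-spline of degree `n + 1` contributes two of degree `n`. After a shift by one, both
    -- sums run over the same B-splines, except for the two end terms, which vanish at `t` by
    -- `hleft` and `hright`.
    have split : ∀ m ∈ Finset.range (n + 1 + 1),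
        C (coxDeBoor x (n + 1) (i - (n + 1 : ℕ) + m) t) *
          knotPoly x (Finset.Ioc (i - (n + 1 : ℕ) + m) (i - (n + 1 : ℕ) + m + (n + 1 : ℕ)))
        = C (coxDeBoor x n (i - n - 1 + m) t) *
            (C ((t - x (i - n - 1 + m)) / (x (i - n - 1 + m + n + 1) - x (i - n - 1 + m))) *
              knotPoly x (Finset.Ioc (i - n - 1 + m) (i - n - 1 + m + n + 1)))
          + C (coxDeBoor x n (i - n + m) t) *
            (C ((x (i - n + m + n + 1) - t) / (x (i - n + m + n + 1) - x (i - n + m))) *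
              knotPoly x (Finset.Ioc (i - n + m - 1) (i - n + m + n))) := by
      intro m _
      have e1 : i - ((n + 1 : ℕ) : ℤ) + m = i - n - 1 + m := by omega
      have e2 : i - n - 1 + m + ((n + 1 : ℕ) : ℤ) = i - n - 1 + m + n + 1 := by omega
      have e3 : i - n - 1 + m + (n : ℤ) + 2 = i - n + m + n + 1 := by omega
      have e4 : i - n - 1 + m + 1 = i - n + (m : ℤ) := by omega
      have e5 : i - n + (m : ℤ) - 1 = i - n - 1 + m := by omega
      have e6 : i - n + (m : ℤ) + n = i - n - 1 + m + n + 1 := by omega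
      rw [e1, e2]
      simp only [coxDeBoor, e3, e4, e5, C_add, C_mul]
      rw [← e6]
      ring
    rw [Finset.sum_congr rfl split, Finset.sum_add_distrib, Finset.sum_range_succ',
      Finset.sum_range_succ (fun m : ℕ => C (coxDeBoor x n (i - n + m) t) * _) (n + 1)]
    have e0 : i - n - 1 + ((0 : ℕ) : ℤ) = i - n - 1 := by simp
    have e1 : i - n + ((n + 1 : ℕ) : ℤ) = i + 1 := by omega
    rw [e0, e1, hleft, hright]
    simp only [C_0, zero_mul, add_zero]
    rw [← Finset.sum_add_distrib]
    refine Finset.sum_congr rfl fun m hm => ?_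
    have hm' := Finset.mem_range.mp hm
    have e2 : i - n - 1 + ((m + 1 : ℕ) : ℤ) = i - n + m := by omega
    rw [e2, ← mul_add, key _ (by omega) (by omega)]
    ring

/-- The functional that sends `(t - X) ^ n` to `t ^ q`. -/
noncomputable def powerFunctional (n q : ℕ) : ℝ[X] →ₗ[ℝ] ℝ :=
  ((-1) ^ (n - q) / (n.choose q : ℝ)) • lcoeff ℝ (n - q)

theorem powerFunctional_pow {n q : ℕ} (hq : q ≤ n) (t : ℝ) :
    powerFunctional n q ((C t - X) ^ n) = t ^ q := by
  have h : (C t - X : ℝ[X]) ^ n = C ((-1) ^ n) * (X - C t) ^ n := by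
    rw [C_pow, ← mul_pow]; simp
  have hc : (n.choose q : ℝ) ≠ 0 := by exact_mod_cast (Nat.choose_pos hq).ne'
  simp only [powerFunctional, LinearMap.smul_apply, lcoeff_apply, smul_eq_mul]
  rw [h, coeff_C_mul, sub_eq_add_neg, ← C_neg, coeff_X_add_C_pow, Nat.choose_symm hq, Nat.sub_sub_self hq]
  field_simp
  obtain ⟨d, rfl⟩ := Nat.exists_eq_add_of_le hq
  rw [Nat.add_sub_cancel_left, neg_pow t q, pow_add]
  have h1 : ((-1 : ℝ) ^ q) * (-1) ^ q = 1 := by rw [← mul_pow]; simp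
  have h2 : ((-1 : ℝ) ^ d) * (-1) ^ d = 1 := by rw [← mul_pow]; simp
  linear_combination (t ^ q * (-1 : ℝ) ^ d * (-1) ^ d) * h1 + t ^ q * h2

theorem sum_powerFunctional_mul_coxDeBoor {x : ℤ → ℝ} {n q : ℕ} (hq : q ≤ n) {i : ℤ} {t : ℝ}
    (hx : StrictMonoOn x (Set.Icc (i - n) (i + n + 1))) (ht : t ∈ Set.Ico (x i) (x (i + 1))) :
    ∑ m ∈ Finset.range (n + 1),
      powerFunctional n q (knotPoly x (Finset.Ioc (i - n + m) (i - n + m + n))) *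
        coxDeBoor x n (i - n + m) t = t ^ q := by
  rw [← powerFunctional_pow hq, ← marsden hx ht, map_sum]
  refine Finset.sum_congr rfl fun m _ => ?_
  rw [C_mul', map_smul, smul_eq_mul, mul_comm]

/-! ### Unisolvence on one knot interval -/

theorem exists_injective_points {a b : ℝ} (h : a < b) (n : ℕ) :
    ∃ t : Fin n → ℝ, Function.Injective t ∧ ∀ i, t i ∈ Set.Ico a b := by
  have hinf : (Set.Ico a b).Infinite := Set.Ico_infinite h
  have := hinf.natEmbedding
  exact ⟨fun i => (this i : ℝ), fun i j hij => Fin.val_injective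
    (this.injective (Subtype.val_injective hij)), fun i => (this i).2⟩

/-- At distinct points of the interval, `sum_powerFunctional_mul_coxDeBoor` says that the product of
the two matrices is a transposed Vandermonde matrix. Its determinant is nonzero, hence so are both
factors. -/
theorem exists_matrix_mul_eq_vandermonde {x : ℤ → ℝ} {n : ℕ} {i : ℤ}
    (hx : StrictMonoOn x (Set.Icc (i - n) (i + n + 1))) :
    ∃ t : Fin (n + 1) → ℝ, (∀ a, t a ∈ Set.Ico (x i) (x (i + 1))) ∧
      (Matrix.of fun (q m : Fin (n + 1)) =>
        powerFunctional n q (knotPoly x (Finset.Ioc (i - n + m) (i - n + m + n)))).det ≠ 0 ∧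
      (Matrix.of fun (m a : Fin (n + 1)) => coxDeBoor x n (i - n + m) (t a)).det ≠ 0 := by
  have hlt : x i < x (i + 1) := hx ⟨by omega, by omega⟩ ⟨by omega, by omega⟩ (by omega)
  obtain ⟨t, hinj, ht⟩ := exists_injective_points hlt (n + 1)
  have hmul : (Matrix.of fun (q m : Fin (n + 1)) =>
        powerFunctional n q (knotPoly x (Finset.Ioc (i - n + m) (i - n + m + n)))) *
      (Matrix.of fun (m a : Fin (n + 1)) => coxDeBoor x n (i - n + m) (t a))
      = (Matrix.vandermonde t).transpose := by
    ext q a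
    rw [Matrix.mul_apply, Matrix.transpose_apply, Matrix.vandermonde_apply,
      ← sum_powerFunctional_mul_coxDeBoor (Nat.lt_succ_iff.mp q.2) hx (ht a), Finset.sum_range]
    rfl
  have hdet := congrArg Matrix.det hmul
  rw [Matrix.det_mul, Matrix.det_transpose] at hdet
  have hv := Matrix.det_vandermonde_ne_zero_iff.mpr hinj
  rw [← hdet] at hv
  exact ⟨t, ht, left_ne_zero_of_mul hv, right_ne_zero_of_mul hv⟩

/-- Local linear independence of the B-splines. -/
theorem eq_zero_of_sum_mul_coxDeBoor_eq_zero {x : ℤ → ℝ} {n : ℕ} {i : ℤ}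
    (hx : StrictMonoOn x (Set.Icc (i - n) (i + n + 1))) {b : ℤ → ℝ}
    (hb : ∀ t ∈ Set.Ico (x i) (x (i + 1)),
      ∑ m ∈ Finset.range (n + 1), b (i - n + m) * coxDeBoor x n (i - n + m) t = 0)
    {j : ℤ} (h1 : i - n ≤ j) (h2 : j ≤ i) : b j = 0 := by
  obtain ⟨t, ht, -, hdet⟩ := exists_matrix_mul_eq_vandermonde hx
  have := Matrix.eq_zero_of_vecMul_eq_zero hdet (v := fun m : Fin (n + 1) => b (i - n + m)) (by
    ext a
    have := hb (t a) (ht a)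
    rw [Finset.sum_range] at this
    simpa [Matrix.vecMul, dotProduct] using this)
  have h := congrFun this ⟨(j - (i - n)).toNat, by omega⟩
  have e : i - n + (((j - (i - n)).toNat : ℕ) : ℤ) = j := by omega
  simpa only [e, Pi.zero_apply] using h

/-- The power coefficients determine values that they combine to power functions. -/
theorem eq_zero_of_sum_powerFunctional_mul_eq_zero {x : ℤ → ℝ} {n : ℕ} {i : ℤ}
    (hx : StrictMonoOn x (Set.Icc (i - n) (i + n + 1))) {v : ℤ → ℝ}
    (hv : ∀ q ≤ n, ∑ m ∈ Finset.range (n + 1),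
      powerFunctional n q (knotPoly x (Finset.Ioc (i - n + m) (i - n + m + n))) *
        v (i - n + m) = 0)
    {j : ℤ} (h1 : i - n ≤ j) (h2 : j ≤ i) : v j = 0 := by
  obtain ⟨-, -, hdet, -⟩ := exists_matrix_mul_eq_vandermonde hx
  have := Matrix.eq_zero_of_mulVec_eq_zero hdet (v := fun m : Fin (n + 1) => v (i - n + m)) (by
    ext q
    have := hv q (Nat.lt_succ_iff.mp q.2)
    rw [Finset.sum_range] at this
    simpa [Matrix.mulVec, dotProduct] using this)
  have h := congrFun this ⟨(j - (i - n)).toNat, by omega⟩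
  have e : i - n + (((j - (i - n)).toNat : ℕ) : ℤ) = j := by omega
  simpa only [e, Pi.zero_apply] using h

/-! ### The parameters of the scheme -/

theorem numR_le_one (p : ℕ) : numR p ≤ 1 := by unfold numR numU; omega

theorem par_nonneg (p : ℕ) : 0 ≤ par p := by unfold par; omega

theorem par_le_one (p : ℕ) : par p ≤ 1 := by unfold par; omega

theorem half_add_par (p : ℕ) : ((p / 2 : ℕ) : ℤ) + par p = 2 * numU p + numR p := by
  unfold par numR numU; omega

theorem two_mul_half_add_par (p : ℕ) : 2 * ((p / 2 : ℕ) : ℤ) + par p = p := by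
  unfold par; omega

theorem rightIdx_eq (p : ℕ) (k : ℤ) : rightIdx p k = k + (p / 2 : ℕ) + par p := by
  unfold rightIdx par; omega

theorem rightIdx_eq_leftIdx_add (p : ℕ) (k : ℤ) : rightIdx p k = leftIdx p k + p := by
  unfold rightIdx leftIdx; omega

/-! ### The knots of the intermediate coefficients -/

/-- The indices of the knots that determine the even coefficient `2 k` after `s` update steps. -/
noncomputable def evenSet (p s : ℕ) (k : ℤ) : Finset ℤ :=
  if s = 0 then Finset.Ioc (leftIdx p (2 * k)) (rightIdx p (2 * k) - 1)
  else (Finset.Icc (2 * k - 2 * mIdx p s - 2 * tIdx p s + 2 * par p)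
      (2 * k + 2 * mIdx p s + 2 * tIdx p s)).filter
    fun i => i % 2 = 0 ∨ (2 * k - 2 * mIdx p s ≤ i ∧ i ≤ 2 * k + 2 * mIdx p s)

/-- The indices of the knots that determine the odd coefficient `2 k + 1` after `i` prediction
steps. -/
noncomputable def oddSet (p i : ℕ) (k : ℤ) : Finset ℤ :=
  if i = 0 then Finset.Ioc (leftIdx p (2 * k + 1)) (rightIdx p (2 * k + 1) - 1)
  else (Finset.Icc (2 * k - 2 * (numU p + i - 1) + 2 * par p) (2 * k + 2 * (numU p + i))).filter
    fun l => l % 2 = 0 ∨ (2 * k - 2 * (numU p + numR p - i) + 2 ≤ l ∧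
      l ≤ 2 * k + 2 * (numU p + numR p - i))

theorem mem_evenSet_zero {p : ℕ} {k i : ℤ} : i ∈ evenSet p 0 k ↔
    2 * k - (p / 2 : ℕ) < i ∧ i < 2 * k + (p / 2 : ℕ) + par p := by
  simp only [evenSet, if_true, Finset.mem_Ioc, leftIdx, rightIdx_eq]; omega

/-- The set is a central block of consecutive knots with only even knots outside it. A generic
update removes the two odd knots bordering the next smaller block and adds one even knot at either
end. -/
theorem mem_evenSet_succ {p s : ℕ} {k i : ℤ} : i ∈ evenSet p (s + 1) k ↔
    (2 * k - 2 * (numU p + numR p + s) + 2 * par p ≤ i ∧ i ≤ 2 * k + 2 * (numU p + numR p + s)) ∧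
      (i % 2 = 0 ∨ (2 * k - 2 * (numU p - s - 1) ≤ i ∧ i ≤ 2 * k + 2 * (numU p - s - 1))) := by
  rw [evenSet, if_neg (Nat.succ_ne_zero s), Finset.mem_filter, Finset.mem_Icc]
  simp only [mIdx, tIdx]
  push_cast
  omega

theorem mem_oddSet_zero {p : ℕ} {k i : ℤ} : i ∈ oddSet p 0 k ↔
    2 * k + 1 - (p / 2 : ℕ) < i ∧ i < 2 * k + 1 + (p / 2 : ℕ) + par p := by
  simp only [oddSet, if_true, Finset.mem_Ioc, leftIdx, rightIdx_eq]; omega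

theorem mem_oddSet_succ {p i : ℕ} {k l : ℤ} : l ∈ oddSet p (i + 1) k ↔
    (2 * k - 2 * (numU p + i) + 2 * par p ≤ l ∧ l ≤ 2 * k + 2 * (numU p + i + 1)) ∧
      (l % 2 = 0 ∨ (2 * k - 2 * (numU p + numR p - i - 1) + 2 ≤ l ∧
      l ≤ 2 * k + 2 * (numU p + numR p - i - 1))) := by
  rw [oddSet, if_neg (Nat.succ_ne_zero i), Finset.mem_filter, Finset.mem_Icc]
  push_cast
  omega

/-! ### Exchange of knots -/

/-- Three linear polynomials are always dependent; this is the relation behind knot insertion. -/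
theorem knotPoly_exchange_one (L : ℝ[X] →ₗ[ℝ] ℝ) (x : ℤ → ℝ) {A : Finset ℤ} {a c d : ℤ}
    (ha : a ∉ A) (hc : c ∉ A) (hd : d ∉ A) :
    (x d - x a) * L (knotPoly x (insert c A)) - (x d - x c) * L (knotPoly x (insert a A))
      = (x c - x a) * L (knotPoly x (insert d A)) := by
  rw [knotPoly_insert x ha, knotPoly_insert x hc, knotPoly_insert x hd]
  simp only [← smul_eq_mul, ← map_smul, ← map_sub]
  congr 1
  simp only [smul_eq_C_mul, C_sub]
  ring

/-- After removal of the common factor, this is a relation between four quadratics in a space of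
dimension three. Its coefficients are the knot differences in the lifting matrices. The order of `a,
b, c, d` serves only to make them distinct. -/
theorem knotPoly_exchange_two (L : ℝ[X] →ₗ[ℝ] ℝ) (x : ℤ → ℝ) {A : Finset ℤ} {a b c d : ℤ}
    (ha : a ∉ A) (hb : b ∉ A) (hc : c ∉ A) (hd : d ∉ A) (hab : a < b) (hbc : b < c) (hcd : c < d) :
    (x d - x a) * L (knotPoly x (insert b (insert c A)))
        - (x d - x c) * L (knotPoly x (insert a (insert b A)))
        - (x b - x a) * L (knotPoly x (insert c (insert d A)))
      = (x c - x b) * L (knotPoly x (insert a (insert d A))) := by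
  rw [knotPoly_insert x (a := b) (by simp [hb, hbc.ne]), knotPoly_insert x hc,
    knotPoly_insert x (a := a) (by simp [ha, hab.ne]), knotPoly_insert x hb,
    knotPoly_insert x (a := c) (by simp [hc, hcd.ne]), knotPoly_insert x hd,
    knotPoly_insert x (a := a) (by simp [ha, (hab.trans (hbc.trans hcd)).ne]), knotPoly_insert x hd]
  simp only [← smul_eq_mul, ← map_smul, ← map_sub]
  congr 1
  simp only [smul_eq_C_mul, C_sub]
  ring

/-- The four index sets share the remainder `A` and differ only in which two of `a, b, c, d` they
contain: the old even set has the inner pair `b, c`, the new one the outer pair `a, d`, and the odd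
neighbours have the left and the right pair. -/
theorem update_exchange (L : ℝ[X] →ₗ[ℝ] ℝ) (x : ℤ → ℝ) {p s : ℕ} (hs : s < numU p)
    (hps : ¬ (numR p = 0 ∧ s = 0 ∧ par p = 1)) {k a b c d : ℤ}
    (ha : a = 2 * k - 2 * (numU p + numR p + s) + 2 * par p)
    (hb : b = 2 * k - 2 * (numU p - s - 1) - 1) (hc : c = 2 * k + 2 * (numU p - s - 1) + 1)
    (hd : d = 2 * k + 2 * (numU p + numR p + s)) :
    (x d - x a) * L (knotPoly x (evenSet p s k))
        - (x d - x c) * L (knotPoly x (oddSet p (numR p + s) (k - 1)))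
        - (x b - x a) * L (knotPoly x (oddSet p (numR p + s) k))
      = (x c - x b) * L (knotPoly x (evenSet p (s + 1) k)) := by
  have h1 := numR_le_one p
  have h2 := par_nonneg p
  have h3 := par_le_one p
  have h4 := half_add_par p
  set A := (evenSet p s k).filter fun i => i ≠ b ∧ i ≠ c with hA
  have hs' : ∀ i, i ∈ A ↔ (i ∈ evenSet p s k ∧ i ≠ b ∧ i ≠ c) := by
    intro i; rw [hA, Finset.mem_filter]
  have e1 : evenSet p s k = insert b (insert c A) := by
    ext i
    simp only [Finset.mem_insert, hs']
    rcases s with _ | s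
    · rw [mem_evenSet_zero]; omega
    · rw [mem_evenSet_succ]; omega
  have e2 : oddSet p (numR p + s) (k - 1) = insert a (insert b A) := by
    ext i
    simp only [Finset.mem_insert, hs']
    rcases s with _ | s
    · rw [mem_evenSet_zero]
      obtain hr | hr : numR p = 0 ∨ numR p = 1 := by omega
      · rw [hr, mem_oddSet_zero]; omega
      · rw [hr, mem_oddSet_succ]; omega
    · rw [mem_evenSet_succ, ← add_assoc, mem_oddSet_succ]; omega
  have e3 : oddSet p (numR p + s) k = insert c (insert d A) := by
    ext i
    simp only [Finset.mem_insert, hs']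
    rcases s with _ | s
    · rw [mem_evenSet_zero]
      obtain hr | hr : numR p = 0 ∨ numR p = 1 := by omega
      · rw [hr, mem_oddSet_zero]; omega
      · rw [hr, mem_oddSet_succ]; omega
    · rw [mem_evenSet_succ, ← add_assoc, mem_oddSet_succ]; omega
  have e4 : evenSet p (s + 1) k = insert a (insert d A) := by
    ext i
    simp only [Finset.mem_insert, hs', mem_evenSet_succ]
    rcases s with _ | s
    · rw [mem_evenSet_zero]; omega
    · rw [mem_evenSet_succ]; omega
  have ha' : a ∉ A := by
    rw [hs']
    rcases s with _ | s
    · rw [mem_evenSet_zero]; omega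
    · rw [mem_evenSet_succ]; omega
  have hd' : d ∉ A := by
    rw [hs']
    rcases s with _ | s
    · rw [mem_evenSet_zero]; omega
    · rw [mem_evenSet_succ]; omega
  rw [e1, e2, e3, e4]
  exact knotPoly_exchange_two L x ha' (by simp [hs']) (by simp [hs']) hd' (by omega) (by omega)
    (by omega)

/-- For odd `p` the initial knots lie asymmetrically about `2 k` and the left odd knot is not among
them, so the very first step exchanges a single knot, on the right. -/
theorem update_exchange_first (L : ℝ[X] →ₗ[ℝ] ℝ) (x : ℤ → ℝ) {p : ℕ} (hs : 0 < numU p)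
    (hr : numR p = 0) (hp : par p = 1) {k a c d : ℤ}
    (ha : a = 2 * k - 2 * (numU p - 1) - 1) (hc : c = 2 * k + 2 * (numU p - 1) + 1)
    (hd : d = 2 * k + 2 * numU p) :
    (x d - x a) * L (knotPoly x (evenSet p 0 k))
        - (x d - x c) * L (knotPoly x (oddSet p 0 (k - 1)))
      = (x c - x a) * L (knotPoly x (evenSet p 1 k)) := by
  have h4 := half_add_par p
  set A := (evenSet p 0 k).filter fun i => i ≠ c with hA
  have hs' : ∀ i, i ∈ A ↔ (i ∈ evenSet p 0 k ∧ i ≠ c) := by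
    intro i; rw [hA, Finset.mem_filter]
  simp only [mem_evenSet_zero] at hs'
  have e1 : evenSet p 0 k = insert c A := by
    ext i
    rw [Finset.mem_insert, hs', mem_evenSet_zero]; omega
  have e2 : oddSet p 0 (k - 1) = insert a A := by
    ext i
    rw [Finset.mem_insert, hs', mem_oddSet_zero]; omega
  have e3 : evenSet p 1 k = insert d A := by
    ext i
    rw [Finset.mem_insert, hs', ← zero_add 1, mem_evenSet_succ]; omega
  have ha' : a ∉ A := by rw [hs']; omega
  have hc' : c ∉ A := by rw [hs']; omega
  have hd' : d ∉ A := by rw [hs']; omega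
  rw [e1, e2, e3, knotPoly_exchange_one L x ha' hc' hd']

theorem predict_exchange_inner (L : ℝ[X] →ₗ[ℝ] ℝ) (x : ℤ → ℝ) {p s i : ℕ} (hs : s < numU p)
    (hi : i + 1 = numR p + s) (hps : ¬ (s = 0 ∧ par p = 1)) {k a b c d : ℤ}
    (ha : a = 2 * k - 2 * (numU p + i) + 2 * par p)
    (hb : b = 2 * k - 2 * (numU p - s) + 1) (hc : c = 2 * k + 2 * (numU p - s) + 1)
    (hd : d = 2 * k + 2 * (numU p + i) + 2) :
    (x d - x a) * L (knotPoly x (oddSet p i k))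
        - (x d - x c) * L (knotPoly x (evenSet p s k))
        - (x b - x a) * L (knotPoly x (evenSet p s (k + 1)))
      = (x c - x b) * L (knotPoly x (oddSet p (i + 1) k)) := by
  have h1 := numR_le_one p
  have h2 := par_nonneg p
  have h3 := par_le_one p
  have h4 := half_add_par p
  set A := (oddSet p i k).filter fun l => l ≠ b ∧ l ≠ c with hA
  have hs' : ∀ l, l ∈ A ↔ (l ∈ oddSet p i k ∧ l ≠ b ∧ l ≠ c) := by
    intro i; rw [hA, Finset.mem_filter]
  have e1 : oddSet p i k = insert b (insert c A) := by
    ext l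
    simp only [Finset.mem_insert, hs']
    rcases i with _ | i
    · rw [mem_oddSet_zero]; omega
    · rw [mem_oddSet_succ]; omega
  have e2 : evenSet p s k = insert a (insert b A) := by
    ext l
    simp only [Finset.mem_insert, hs']
    rcases i with _ | i
    · rw [mem_oddSet_zero]
      rcases s with _ | s
      · rw [mem_evenSet_zero]; omega
      · rw [mem_evenSet_succ]; omega
    · rw [mem_oddSet_succ]
      rcases s with _ | s
      · omega
      · rw [mem_evenSet_succ]; omega
  have e3 : evenSet p s (k + 1) = insert c (insert d A) := by
    ext l
    simp only [Finset.mem_insert, hs']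
    rcases i with _ | i
    · rw [mem_oddSet_zero]
      rcases s with _ | s
      · rw [mem_evenSet_zero]; omega
      · rw [mem_evenSet_succ]; omega
    · rw [mem_oddSet_succ]
      rcases s with _ | s
      · omega
      · rw [mem_evenSet_succ]; omega
  have e4 : oddSet p (i + 1) k = insert a (insert d A) := by
    ext l
    simp only [Finset.mem_insert, hs', mem_oddSet_succ]
    rcases i with _ | i
    · rw [mem_oddSet_zero]; omega
    · rw [mem_oddSet_succ]; omega
  have ha' : a ∉ A := by
    rw [hs']
    rcases i with _ | i
    · rw [mem_oddSet_zero]; omega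
    · rw [mem_oddSet_succ]; omega
  have hd' : d ∉ A := by
    rw [hs']
    rcases i with _ | i
    · rw [mem_oddSet_zero]; omega
    · rw [mem_oddSet_succ]; omega
  rw [e1, e2, e3, e4]
  exact knotPoly_exchange_two L x ha' (by simp [hs']) (by simp [hs']) hd' (by omega) (by omega)
    (by omega)

theorem predict_exchange_first (L : ℝ[X] →ₗ[ℝ] ℝ) (x : ℤ → ℝ) {p : ℕ}
    (hr : numR p = 1) (hp : par p = 1) {k a c d : ℤ}
    (ha : a = 2 * k - 2 * numU p + 1) (hc : c = 2 * k + 2 * numU p + 1)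
    (hd : d = 2 * k + 2 * numU p + 2) :
    (x d - x a) * L (knotPoly x (oddSet p 0 k)) - (x d - x c) * L (knotPoly x (evenSet p 0 k))
      = (x c - x a) * L (knotPoly x (oddSet p 1 k)) := by
  have h4 := half_add_par p
  -- No update steps together with `r = 1` and odd order means order `1`: there are no interior
  -- knots, and `a = c` makes both sides zero.
  obtain hu | hu := Nat.eq_zero_or_pos (numU p)
  · have e1 : oddSet p 0 k = ∅ := by
      ext l; rw [mem_oddSet_zero]; simp only [Finset.notMem_empty, iff_false]; omega
    have e2 : evenSet p 0 k = ∅ := by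
      ext l; rw [mem_evenSet_zero]; simp only [Finset.notMem_empty, iff_false]; omega
    have e3 : a = c := by omega
    rw [e1, e2, e3]; ring
  · set A := (oddSet p 0 k).filter fun i => i ≠ c with hA
    have hs' : ∀ i, i ∈ A ↔ (i ∈ oddSet p 0 k ∧ i ≠ c) := by
      intro i; rw [hA, Finset.mem_filter]
    simp only [mem_oddSet_zero] at hs'
    have e1 : oddSet p 0 k = insert c A := by
      ext i
      rw [Finset.mem_insert, hs', mem_oddSet_zero]; omega
    have e2 : evenSet p 0 k = insert a A := by
      ext i
      rw [Finset.mem_insert, hs', mem_evenSet_zero]; omega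
    have e3 : oddSet p 1 k = insert d A := by
      ext i
      rw [Finset.mem_insert, hs', ← zero_add 1, mem_oddSet_succ]; omega
    have ha' : a ∉ A := by rw [hs']; omega
    have hc' : c ∉ A := by rw [hs']; omega
    have hd' : d ∉ A := by rw [hs']; omega
    rw [e1, e2, e3, knotPoly_exchange_one L x ha' hc' hd']

/-- In the last prediction `b = c`, so only one knot differs between the three sets and the linear
relation leaves nothing over. This is the reason for zero details. -/
theorem predict_exchange_last (L : ℝ[X] →ₗ[ℝ] ℝ) (x : ℤ → ℝ) {p i : ℕ}
    (hi : i + 1 = numR p + numU p) (hps : ¬ (numU p = 0 ∧ par p = 1)) {k a c d : ℤ}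
    (ha : a = 2 * k - 2 * (numU p + i) + 2 * par p) (hc : c = 2 * k + 1)
    (hd : d = 2 * k + 2 * (numU p + i) + 2) :
    (x d - x a) * L (knotPoly x (oddSet p i k))
        - (x d - x c) * L (knotPoly x (evenSet p (numU p) k))
        - (x c - x a) * L (knotPoly x (evenSet p (numU p) (k + 1))) = 0 := by
  have h1 := numR_le_one p
  have h2 := par_nonneg p
  have h3 := par_le_one p
  have h4 := half_add_par p
  generalize hs : numU p = s
  rw [hs] at hi hps
  set A := (oddSet p i k).filter fun l => l ≠ c with hA
  have hs' : ∀ l, l ∈ A ↔ (l ∈ oddSet p i k ∧ l ≠ c) := by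
    intro i; rw [hA, Finset.mem_filter]
  have e1 : oddSet p i k = insert c A := by
    ext l
    simp only [Finset.mem_insert, hs']
    rcases i with _ | i
    · rw [mem_oddSet_zero]; omega
    · rw [mem_oddSet_succ]; omega
  have e2 : evenSet p s k = insert a A := by
    ext l
    simp only [Finset.mem_insert, hs']
    rcases i with _ | i
    · rw [mem_oddSet_zero]
      rcases s with _ | s
      · rw [mem_evenSet_zero]; omega
      · rw [mem_evenSet_succ]; omega
    · rw [mem_oddSet_succ]
      rcases s with _ | s
      · omega
      · rw [mem_evenSet_succ]; omega
  have e3 : evenSet p s (k + 1) = insert d A := by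
    ext l
    simp only [Finset.mem_insert, hs']
    rcases i with _ | i
    · rw [mem_oddSet_zero]
      rcases s with _ | s
      · rw [mem_evenSet_zero]; omega
      · rw [mem_evenSet_succ]; omega
    · rw [mem_oddSet_succ]
      rcases s with _ | s
      · omega
      · rw [mem_evenSet_succ]; omega
  have ha' : a ∉ A := by
    rw [hs']
    rcases i with _ | i
    · rw [mem_oddSet_zero]; omega
    · rw [mem_oddSet_succ]; omega
  have hd' : d ∉ A := by
    rw [hs']
    rcases i with _ | i
    · rw [mem_oddSet_zero]; omega
    · rw [mem_oddSet_succ]; omega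
  have hc' : c ∉ A := by simp [hs']
  rw [e1, e2, e3]
  linarith [knotPoly_exchange_one L x ha' hc' hd']

/-! ### The factors -/

theorem evenFactor_ne_zero {x : ℤ → ℝ} {p s : ℕ} (hs : s ≤ numU p) {k : ℤ}
    (hx : StrictMonoOn x (Set.Icc (2 * k - 2 * (numU p + numR p + s - 1) + par p)
      (2 * k + 2 * (numU p + numR p + s - 1)))) : evenFactor x p s k ≠ 0 := by
  have h1 := numR_le_one p
  have h2 := par_nonneg p
  have h3 := par_le_one p
  induction s with
  | zero => simp [evenFactor]
  | succ s ih =>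
    push_cast at hx
    have lt : ∀ i j : ℤ, 2 * k - 2 * (numU p + numR p + (s + 1) - 1) + par p ≤ i → i < j →
        j ≤ 2 * k + 2 * (numU p + numR p + (s + 1) - 1) → x j - x i ≠ 0 :=
      fun i j hi hij hj => (sub_pos.mpr (hx ⟨hi, by omega⟩ ⟨by omega, hj⟩ hij)).ne'
    refine mul_ne_zero (ih (by omega) (hx.mono (Set.Icc_subset_Icc (by omega) (by omega))))
      (div_ne_zero (lt _ _ ?_ ?_ ?_) (lt _ _ ?_ ?_ ?_)) <;>
    · simp only [mIdx, tIdx, shiftU]; (try split_ifs) <;> omega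

/-- The strict bound on `i` is essential: the last odd factor contains `x (2 k + 1) - x (2 k + 1) =
0`. The scheme never divides by that one. -/
theorem oddFactor_ne_zero {x : ℤ → ℝ} {p i : ℕ} (hi : i < numR p + numU p) {k : ℤ}
    (hx : StrictMonoOn x (Set.Icc (2 * k - 2 * (numU p + i - 1) + par p)
      (2 * k + 2 * (numU p + i)))) : oddFactor x p i k ≠ 0 := by
  have h1 := numR_le_one p
  have h2 := par_nonneg p
  have h3 := par_le_one p
  induction i with
  | zero => simp [oddFactor]
  | succ i ih =>
    push_cast at hx
    have lt : ∀ l j : ℤ, 2 * k - 2 * (numU p + (i + 1) - 1) + par p ≤ l → l < j →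
        j ≤ 2 * k + 2 * (numU p + (i + 1)) → x j - x l ≠ 0 :=
      fun i j hi hij hj => (sub_pos.mpr (hx ⟨hi, by omega⟩ ⟨by omega, hj⟩ hij)).ne'
    refine mul_ne_zero (ih (by omega) (hx.mono (Set.Icc_subset_Icc (by omega) (by omega))))
      (div_ne_zero (lt _ _ ?_ ?_ ?_) (lt _ _ ?_ ?_ ?_)) <;>
    · simp only [mIdx, tIdx, shiftP]; (try split_ifs) <;> omega

/-! ### The forward transform of power coefficients -/

theorem mulV_updateMatrix (x : ℤ → ℝ) (p s : ℕ) (v : ℤ → ℝ) (k : ℤ) :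
    mulV (updateMatrix x p s) v k =
      updateMatrix x p s k k * v k + updateMatrix x p s k (k - 1) * v (k - 1) := by
  unfold mulV
  rw [finsum_eq_sum_of_support_subset (s := {k, k - 1}), Finset.sum_pair (by omega)]
  intro l hl
  by_contra h
  simp only [Finset.coe_insert, Finset.coe_singleton, Set.mem_insert_iff, Set.mem_singleton_iff,
    not_or] at h
  exact hl (by simp [updateMatrix, h.1, h.2])

theorem mulV_predictMatrix (x : ℤ → ℝ) (p s : ℕ) (v : ℤ → ℝ) (k : ℤ) :
    mulV (predictMatrix x p s) v k =
      predictMatrix x p s k k * v k + predictMatrix x p s k (k + 1) * v (k + 1) := by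
  unfold mulV
  rw [finsum_eq_sum_of_support_subset (s := {k, k + 1}), Finset.sum_pair (by omega)]
  intro l hl
  by_contra h
  simp only [Finset.coe_insert, Finset.coe_singleton, Set.mem_insert_iff, Set.mem_singleton_iff,
    not_or] at h
  exact hl (by simp [predictMatrix, h.1, h.2])

theorem mulV_scaleMatrix (x : ℤ → ℝ) (p : ℕ) (v : ℤ → ℝ) (k : ℤ) :
    mulV (scaleMatrix x p) v k = evenFactor x p (numU p) k * v k := by
  unfold mulV
  rw [finsum_eq_single _ k fun l hl => by simp [scaleMatrix, Matrix.diagonal_apply_ne' _ hl]]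
  simp [scaleMatrix]

theorem update_exchange_shiftU (L : ℝ[X] →ₗ[ℝ] ℝ) (x : ℤ → ℝ) {p s : ℕ} (hs : s < numU p) (k : ℤ) :
    denU x p (s + 1) k * L (knotPoly x (evenSet p s k))
        - (x (2 * k + 2 * mIdx p (s + 1) + 2 * tIdx p (s + 1)) - x (2 * k + 2 * mIdx p (s + 1) + 1))
          * L (knotPoly x (oddSet p (numR p + s) (k - 1)))
        - (x (2 * k - 2 * mIdx p (s + 1) - 1)
            - x (2 * k - 2 * mIdx p (s + 1) - 2 * tIdx p (s + 1) + shiftU p (s + 1)))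
          * L (knotPoly x (oddSet p (numR p + s) k))
      = (x (2 * k + 2 * mIdx p (s + 1) + 1) - x (2 * k - 2 * mIdx p (s + 1) - 1))
          * L (knotPoly x (evenSet p (s + 1) k)) := by
  have h2 := par_nonneg p
  have h3 := par_le_one p
  unfold denU
  by_cases hps : numR p = 0 ∧ s = 0 ∧ par p = 1
  · obtain ⟨hr, rfl, hp⟩ := hps
    -- Here `ũ = 1` makes the incoming left knot equal to the outgoing one, so the term with the odd
    -- neighbour `k` drops out.
    have hab : 2 * k - 2 * mIdx p (0 + 1) - 2 * tIdx p (0 + 1) + shiftU p (0 + 1)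
        = 2 * k - 2 * mIdx p (0 + 1) - 1 := by simp [shiftU, mIdx, tIdx, hr, hp]; omega
    rw [hab, sub_self, zero_mul, sub_zero, hr]
    exact update_exchange_first L x hs hr hp (by simp only [mIdx]; omega)
      (by simp only [mIdx]; omega) (by simp only [mIdx, tIdx]; omega)
  · refine update_exchange L x hs hps ?_ ?_ ?_ ?_
    · simp only [mIdx, tIdx, shiftU]; split_ifs <;> omega
    all_goals simp only [mIdx, tIdx]; omega

theorem predict_exchange_shiftP (L : ℝ[X] →ₗ[ℝ] ℝ) (x : ℤ → ℝ) {p s i : ℕ} (hs : s ≤ numU p)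
    (hi : i + 1 = numR p + s) (k : ℤ) :
    denP x p s k * L (knotPoly x (oddSet p i k))
        - (x (2 * k + 2 * mIdx p s + 2 * tIdx p s + 2) - x (2 * k + 2 * mIdx p s + 1))
          * L (knotPoly x (evenSet p s k))
        - (x (2 * k - 2 * mIdx p s + 1) - x (2 * k - 2 * mIdx p s - 2 * tIdx p s + shiftP p s))
          * L (knotPoly x (evenSet p s (k + 1)))
      = (x (2 * k + 2 * mIdx p s + 1) - x (2 * k - 2 * mIdx p s + 1))
          * L (knotPoly x (oddSet p (i + 1) k)) := by
  have h1 := numR_le_one p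
  have h2 := par_nonneg p
  have h3 := par_le_one p
  unfold denP
  by_cases hps : s = 0 ∧ par p = 1
  · obtain ⟨rfl, hp⟩ := hps
    obtain rfl : i = 0 := by omega
    have hr : numR p = 1 := by omega
    have hab : 2 * k - 2 * mIdx p 0 - 2 * tIdx p 0 + shiftP p 0 = 2 * k - 2 * mIdx p 0 + 1 := by
      simp [shiftP, mIdx, tIdx, hr, hp]
    rw [hab, sub_self, zero_mul, sub_zero]
    exact predict_exchange_first L x hr hp (by simp only [mIdx]; omega)
      (by simp only [mIdx]; omega) (by simp only [mIdx, tIdx]; omega)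
  · have ha : 2 * k - 2 * mIdx p s - 2 * tIdx p s + shiftP p s
        = 2 * k - 2 * (numU p + i) + 2 * par p := by
      simp only [mIdx, tIdx, shiftP]; split_ifs <;> omega
    obtain hlt | rfl := hs.lt_or_eq
    · exact predict_exchange_inner L x hlt hi hps ha rfl rfl (by simp only [mIdx, tIdx]; omega)
    · have hm : mIdx p (numU p) = 0 := by simp [mIdx]
      have := predict_exchange_last L x hi hps (k := k) (a := 2 * k - 2 * mIdx p (numU p)
        - 2 * tIdx p (numU p) + shiftP p (numU p)) (c := 2 * k + 2 * mIdx p (numU p) + 1)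
        (d := 2 * k + 2 * mIdx p (numU p) + 2 * tIdx p (numU p) + 2) ha (by simp [hm])
        (by simp only [mIdx, tIdx]; omega)
      simp only [hm, mul_zero, add_zero, sub_zero] at this ⊢
      rw [this, sub_self, zero_mul]

/-- The quotients of factors in the update matrix cancel the odd factors and leave the old even
factor in common; the rest is the exchange identity divided by `denU`. -/
theorem update_step (L : ℝ[X] →ₗ[ℝ] ℝ) {x : ℤ → ℝ} {p s : ℕ} (hs : s < numU p) {k : ℤ}
    (hx : StrictMonoOn x (Set.Icc (2 * k - 2 * (numU p + numR p + s) + par p)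
      (2 * k + 2 * (numU p + numR p + s)))) :
    evenFactor x p s k * L (knotPoly x (evenSet p s k))
        + (updateMatrix x p (s + 1) k k *
            (oddFactor x p (numR p + s) k * L (knotPoly x (oddSet p (numR p + s) k)))
          + updateMatrix x p (s + 1) k (k - 1) *
            (oddFactor x p (numR p + s) (k - 1) * L (knotPoly x (oddSet p (numR p + s) (k - 1)))))
      = evenFactor x p (s + 1) k * L (knotPoly x (evenSet p (s + 1) k)) := by
  have h1 := numR_le_one p
  have h2 := par_nonneg p
  have h3 := par_le_one p
  have hD : denU x p (s + 1) k ≠ 0 := by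
    refine (sub_pos.mpr (hx ?_ ?_ ?_)).ne'
    · simp only [Set.mem_Icc, mIdx, tIdx, shiftU]; split_ifs <;> omega
    · simp only [Set.mem_Icc, mIdx, tIdx]; omega
    · simp only [mIdx, tIdx, shiftU]; split_ifs <;> omega
  have ho : oddFactor x p (numR p + s) k ≠ 0 :=
    oddFactor_ne_zero (by omega) (hx.mono (Set.Icc_subset_Icc (by omega) (by omega)))
  have ho' : oddFactor x p (numR p + s) (k - 1) ≠ 0 :=
    oddFactor_ne_zero (by omega) (hx.mono (Set.Icc_subset_Icc (by omega) (by omega)))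
  have e1 : numR p + (s + 1) - 1 = numR p + s := by omega
  have hne : k - 1 ≠ k := by omega
  have key := update_exchange_shiftU L x hs k
  simp only [updateMatrix, if_pos, hne, if_false, e1, Nat.add_sub_cancel, evenFactor]
  field_simp
  linear_combination evenFactor x p s k * key

theorem predict_step (L : ℝ[X] →ₗ[ℝ] ℝ) {x : ℤ → ℝ} {p s i : ℕ} (hs : s ≤ numU p)
    (hi : i + 1 = numR p + s) {k : ℤ}
    (hx : StrictMonoOn x (Set.Icc (2 * k - 2 * (numU p + i) + par p)
      (2 * k + 2 * (numU p + i + 1)))) :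
    oddFactor x p i k * L (knotPoly x (oddSet p i k))
        - (predictMatrix x p s k k *
            (evenFactor x p s k * L (knotPoly x (evenSet p s k)))
          + predictMatrix x p s k (k + 1) *
            (evenFactor x p s (k + 1) * L (knotPoly x (evenSet p s (k + 1)))))
      = oddFactor x p (i + 1) k * L (knotPoly x (oddSet p (i + 1) k)) := by
  have h1 := numR_le_one p
  have h2 := par_nonneg p
  have h3 := par_le_one p
  have h4 := half_add_par p
  have hD : denP x p s k ≠ 0 := by
    refine (sub_pos.mpr (hx ?_ ?_ ?_)).ne'
    · simp only [Set.mem_Icc, mIdx, tIdx, shiftP]; split_ifs <;> omega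
    · simp only [Set.mem_Icc, mIdx, tIdx]; omega
    · simp only [mIdx, tIdx, shiftP]; split_ifs <;> omega
  have he : evenFactor x p s k ≠ 0 :=
    evenFactor_ne_zero hs (hx.mono (Set.Icc_subset_Icc (by omega) (by omega)))
  have he' : evenFactor x p s (k + 1) ≠ 0 :=
    evenFactor_ne_zero hs (hx.mono (Set.Icc_subset_Icc (by omega) (by omega)))
  have e1 : numR p + s - 1 = i := by omega
  have e2 : i + 1 - numR p = s := by omega
  have hne : k + 1 ≠ k := by omega
  have key := predict_exchange_shiftP L x hs hi k
  simp only [predictMatrix, if_pos, hne, if_false, e1, oddFactor, e2]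
  field_simp
  linear_combination oddFactor x p i k * key

/-- The number `w` is the radius of dependence: after the given steps, a coefficient depends only on
fine coefficients at distance at most `w`. The membership conditions make all of these inner, so
that `ha` applies to them. For even coefficients `w` is the parameter `t` of the last update, or `0`
before any update. -/
theorem lift_eq (L : ℝ[X] →ₗ[ℝ] ℝ) {x : ℤ → ℝ} {p : ℕ} {J : Set ℤ} (hJ : J.OrdConnected)
    (hx : StrictMonoOn x J) {a : ℤ → ℝ}
    (ha : ∀ l, leftIdx p l ∈ J → rightIdx p l ∈ J →
      a l = L (knotPoly x (Finset.Ioc (leftIdx p l) (rightIdx p l - 1))))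
    {s : ℕ} (hs : s ≤ numU p) :
    (∀ k w, w = (if s = 0 then 0 else (numR p : ℤ) + 2 * s - 1) →
      leftIdx p (2 * k - w) ∈ J → rightIdx p (2 * k + w) ∈ J →
      (lift x p a s).1 k = evenFactor x p s k * L (knotPoly x (evenSet p s k))) ∧
    (∀ k w, w = (numR p : ℤ) + 2 * s →
      leftIdx p (2 * k + 1 - w) ∈ J → rightIdx p (2 * k + 1 + w) ∈ J →
      (lift x p a s).2 k =
        oddFactor x p (numR p + s) k * L (knotPoly x (oddSet p (numR p + s) k))) := by
  have h1 := numR_le_one p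
  have h2 := par_nonneg p
  have h3 := par_le_one p
  have h4 := half_add_par p
  have mem : ∀ {b c : ℤ}, b ∈ J → c ∈ J → ∀ {d}, b ≤ d → d ≤ c → d ∈ J :=
    fun hb hc _ h h' => hJ.out hb hc ⟨h, h'⟩
  have mono : ∀ {b c : ℤ}, b ∈ J → c ∈ J → ∀ {d e : ℤ}, b ≤ d → e ≤ c →
      StrictMonoOn x (Set.Icc d e) :=
    fun hb hc _ _ h h' => hx.mono ((Set.Icc_subset_Icc h h').trans (hJ.out hb hc))
  simp only [leftIdx, rightIdx_eq] at ha mem mono ⊢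
  induction s with
  | zero =>
    have heven : ∀ k, 2 * k - ((p / 2 : ℕ) : ℤ) ∈ J → 2 * k + ((p / 2 : ℕ) : ℤ) + par p ∈ J →
        a (2 * k) = evenFactor x p 0 k * L (knotPoly x (evenSet p 0 k)) := by
      intro k hl hr
      rw [ha _ hl hr]
      simp [evenFactor, evenSet, leftIdx, rightIdx_eq]
    have hodd : ∀ k, 2 * k + 1 - ((p / 2 : ℕ) : ℤ) ∈ J →
        2 * k + 1 + ((p / 2 : ℕ) : ℤ) + par p ∈ J →
        a (2 * k + 1) = oddFactor x p 0 k * L (knotPoly x (oddSet p 0 k)) := by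
      intro k hl hr
      rw [ha _ hl hr]
      simp [oddFactor, oddSet, leftIdx, rightIdx_eq]
    refine ⟨?_, ?_⟩
    · rintro k w rfl hl hr
      exact heven k (by simpa using hl) (by simpa using hr)
    · rintro k w rfl hl hr
      simp only [lift]
      obtain h | h : numR p = 0 ∨ numR p = 1 := by omega
      · simp only [h, zero_ne_one, if_false] at hl hr ⊢
        exact hodd k (by simpa using hl) (by simpa using hr)
      · rw [if_pos h]
        simp only [Pi.sub_apply, mulV_predictMatrix]
        rw [hodd k (mem hl hr (by omega) (by omega)) (mem hl hr (by omega) (by omega)),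
          heven k (mem hl hr (by omega) (by omega)) (mem hl hr (by omega) (by omega)),
          heven (k + 1) (mem hl hr (by omega) (by omega)) (mem hl hr (by omega) (by omega)),
          predict_step L hs (by omega) (mono hl hr (by omega) (by omega)), h]
  | succ s ih =>
    obtain ⟨ihe, iho⟩ := ih (by omega)
    have heven : ∀ k, 2 * k - ((numR p : ℤ) + 2 * s + 1) - ((p / 2 : ℕ) : ℤ) ∈ J →
        2 * k + ((numR p : ℤ) + 2 * s + 1) + ((p / 2 : ℕ) : ℤ) + par p ∈ J →
        (lift x p a (s + 1)).1 k
          = evenFactor x p (s + 1) k * L (knotPoly x (evenSet p (s + 1) k)) := by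
      intro k hl hr
      simp only [lift, Pi.add_apply, mulV_updateMatrix]
      rw [ihe k _ rfl (mem hl hr (by split_ifs <;> omega) (by split_ifs <;> omega))
          (mem hl hr (by split_ifs <;> omega) (by split_ifs <;> omega)),
        iho k _ rfl (mem hl hr (by omega) (by omega)) (mem hl hr (by omega) (by omega)),
        iho (k - 1) _ rfl (mem hl hr (by omega) (by omega)) (mem hl hr (by omega) (by omega)),
        update_step L (by omega) (mono hl hr (by omega) (by omega))]
    refine ⟨?_, ?_⟩
    · rintro k w rfl hl hr
      rw [if_neg (Nat.succ_ne_zero s)] at hl hr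
      exact heven k (mem hl hr (by omega) (by omega)) (mem hl hr (by omega) (by omega))
    · rintro k w rfl hl hr
      have h := predict_step L (x := x) hs (i := numR p + s) (k := k) (by omega)
        (mono hl hr (by omega) (by omega))
      rw [← heven k (mem hl hr (by omega) (by omega)) (mem hl hr (by omega) (by omega)),
        ← heven (k + 1) (mem hl hr (by omega) (by omega)) (mem hl hr (by omega) (by omega)),
        ← iho k _ rfl (mem hl hr (by omega) (by omega)) (mem hl hr (by omega) (by omega)),
        ← mulV_predictMatrix] at h
      exact h

/-- On a grid with strictly increasing knots, the forward transform maps the image of the dual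
polynomials of the fine B-splines to that of the coarse ones. -/
theorem coarseCoeff_eq (L : ℝ[X] →ₗ[ℝ] ℝ) {x : ℤ → ℝ} {p : ℕ} (hp : 1 ≤ p) {J : Set ℤ}
    (hJ : J.OrdConnected) (hx : StrictMonoOn x J) {a : ℤ → ℝ}
    (ha : ∀ l, leftIdx p l ∈ J → rightIdx p l ∈ J →
      a l = L (knotPoly x (Finset.Ioc (leftIdx p l) (rightIdx p l - 1))))
    {k : ℤ} (hl : 2 * leftIdx p k ∈ J) (hr : 2 * rightIdx p k ∈ J) :
    coarseCoeff x p a k =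
      L (knotPoly (fun i => x (2 * i)) (Finset.Ioc (leftIdx p k) (rightIdx p k - 1))) := by
  have h1 := numR_le_one p
  have h2 := par_nonneg p
  have h3 := par_le_one p
  have h4 := half_add_par p
  have h5 := two_mul_half_add_par p
  have mem : ∀ {d : ℤ}, 2 * leftIdx p k ≤ d → d ≤ 2 * rightIdx p k → d ∈ J :=
    fun h h' => hJ.out hl hr ⟨h, h'⟩
  have hmono : StrictMonoOn x (Set.Icc (2 * leftIdx p k) (2 * rightIdx p k)) :=
    hx.mono (hJ.out hl hr)
  have hc : evenFactor x p (numU p) k ≠ 0 :=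
    evenFactor_ne_zero le_rfl (hmono.mono (Set.Icc_subset_Icc
      (by simp only [leftIdx]; omega) (by simp only [rightIdx_eq]; omega)))
  -- After the last update the central block has shrunk to `2 k`, so the remaining indices are
  -- exactly the doubles of the interior coarse ones.
  have hset : knotPoly (fun i => x (2 * i)) (Finset.Ioc (leftIdx p k) (rightIdx p k - 1))
      = knotPoly x (evenSet p (numU p) k) := by
    unfold knotPoly
    refine Finset.prod_bij (fun i _ => 2 * i) ?_ ?_ ?_ ?_
    · intro i hi
      simp only [Finset.mem_Ioc, leftIdx, rightIdx_eq] at hi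
      generalize hs : numU p = s at *
      rcases s with _ | s
      · rw [mem_evenSet_zero]; omega
      · rw [mem_evenSet_succ]; omega
    · intro i _ j _ h
      simpa using h
    · intro i hi
      refine ⟨i / 2, ?_, ?_⟩
      · simp only [Finset.mem_Ioc, leftIdx, rightIdx_eq]
        generalize hs : numU p = s at *
        rcases s with _ | s
        · rw [mem_evenSet_zero] at hi; omega
        · rw [mem_evenSet_succ] at hi; omega
      · generalize hs : numU p = s at *
        rcases s with _ | s
        · rw [mem_evenSet_zero] at hi; omega
        · rw [mem_evenSet_succ] at hi; omega
    · intro i _; rfl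
  have hlift := (lift_eq L hJ hx ha (le_refl (numU p))).1 k _ rfl
    (mem (by simp only [leftIdx]; split_ifs <;> omega)
      (by simp only [leftIdx, rightIdx_eq]; split_ifs <;> omega))
    (mem (by simp only [leftIdx, rightIdx_eq]; split_ifs <;> omega)
      (by simp only [rightIdx_eq]; split_ifs <;> omega))
  rw [coarseCoeff, hlift, hset, scaleMatrix, Matrix.diagonal_apply_eq, inv_mul_cancel_left₀ hc]

theorem detailCoeff_eq_zero (L : ℝ[X] →ₗ[ℝ] ℝ) {x : ℤ → ℝ} {p : ℕ} (hp : 1 ≤ p) {J : Set ℤ}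
    (hJ : J.OrdConnected) (hx : StrictMonoOn x J) {a : ℤ → ℝ}
    (ha : ∀ l, leftIdx p l ∈ J → rightIdx p l ∈ J →
      a l = L (knotPoly x (Finset.Ioc (leftIdx p l) (rightIdx p l - 1))))
    {k : ℤ} (hl : 2 * leftIdx p k ∈ J) (hr : 2 * rightIdx p (k + 1) ∈ J) :
    detailCoeff x p a k = 0 := by
  have h1 := numR_le_one p
  have h2 := par_nonneg p
  have h3 := par_le_one p
  have h4 := half_add_par p
  have h5 := two_mul_half_add_par p
  have mem : ∀ {d : ℤ}, 2 * leftIdx p k ≤ d → d ≤ 2 * rightIdx p (k + 1) → d ∈ J :=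
    fun h h' => hJ.out hl hr ⟨h, h'⟩
  rw [detailCoeff, (lift_eq L hJ hx ha (le_refl (numU p))).2 k _ rfl
    (mem (by simp only [leftIdx]; omega) (by simp only [leftIdx, rightIdx_eq]; omega))
    (mem (by simp only [leftIdx, rightIdx_eq]; omega) (by simp only [rightIdx_eq]; omega))]
  -- For `p ≥ 1` there is a last prediction step; it has `m = 0`, so the numerator of its factor is
  -- zero.
  obtain ⟨i, hi⟩ : ∃ i, numR p + numU p = i + 1 := ⟨numR p + numU p - 1, by omega⟩
  have e : i + 1 - numR p = numU p := by omega
  simp [hi, oddFactor, e, mIdx]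

/-! ### The inverse transform -/

theorem unlift_lift (x : ℤ → ℝ) (p : ℕ) (a : ℤ → ℝ) (s : ℕ) :
    unlift x p s (lift x p a s).1 (lift x p a s).2
      = (fun k => a (2 * k), fun k => a (2 * k + 1)) := by
  induction s with
  | zero =>
    simp only [unlift, lift]
    split_ifs <;> simp
  | succ s ih =>
    simpa only [unlift, lift, sub_add_cancel, add_sub_cancel_right] using ih

/-- Perfect reconstruction: with vanishing details, the scaling coefficients alone determine the
input. Applied to power coefficients, it shows how the inverse scheme acts on them. -/
theorem synthesis_coarseCoeff {x : ℤ → ℝ} {p : ℕ} {a : ℤ → ℝ}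
    (hc : ∀ k, evenFactor x p (numU p) k ≠ 0) (hd : ∀ k, detailCoeff x p a k = 0) (l : ℤ) :
    synthesis x p (coarseCoeff x p a) 0 l = a l := by
  have h1 : mulV (scaleMatrix x p) (coarseCoeff x p a) = (lift x p a (numU p)).1 := by
    ext k
    rw [mulV_scaleMatrix, coarseCoeff, scaleMatrix, Matrix.diagonal_apply_eq,
      mul_inv_cancel_left₀ (hc k)]
  have h2 : (0 : ℤ → ℝ) = (lift x p a (numU p)).2 := by
    ext k
    exact (hd k).symm
  simp only [synthesis]
  rw [h1, h2, unlift_lift]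
  split_ifs with h
  · exact congrArg a (by have := Int.even_iff.mp h; omega)
  · exact congrArg a (by have := Int.not_even_iff.mp h; omega)

/-! ### Finite rows of the inverse transform -/

/-- The functionals on sequences that combine finitely many entries. -/
def entrySpan : Submodule ℝ ((ℤ → ℝ) → ℝ) :=
  Submodule.span ℝ (Set.range fun (k : ℤ) (c : ℤ → ℝ) => c k)

/-- Sequences of power coefficients are in general not finitely supported, so linearity alone does
not recover `f` from its values on unit vectors; a finite row does. -/
theorem eq_finsum_of_mem_entrySpan {f : (ℤ → ℝ) → ℝ} (hf : f ∈ entrySpan) :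
    ∃ K : Finset ℤ, (∀ k, f (Pi.single k 1) ≠ 0 → k ∈ K) ∧
      ∀ c, f c = ∑ k ∈ K, f (Pi.single k 1) * c k := by
  obtain ⟨w, rfl⟩ := (Finsupp.mem_span_range_iff_exists_finsupp).mp hf
  have h : ∀ c : ℤ → ℝ, (w.sum fun i a => a • fun c : ℤ → ℝ => c i) c
      = ∑ k ∈ w.support, w k * c k := by
    intro c
    rw [Finsupp.sum, Finset.sum_apply]
    rfl
  have hw : ∀ k, (w.sum fun i a => a • fun c : ℤ → ℝ => c i) (Pi.single k 1) = w k := by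
    intro k
    rw [h]
    simpa [Pi.single_apply] using Eq.symm
  refine ⟨w.support, fun k hk => ?_, fun c => ?_⟩
  · rw [hw] at hk
    exact Finsupp.mem_support_iff.mpr hk
  · rw [h]
    exact Finset.sum_congr rfl fun k _ => by rw [hw]

theorem mulV_updateMatrix_mem_entrySpan {x : ℤ → ℝ} {p s : ℕ} {T : (ℤ → ℝ) → ℤ → ℝ}
    (hT : ∀ k, (fun c => T c k) ∈ entrySpan) (k : ℤ) :
    (fun c => mulV (updateMatrix x p s) (T c) k) ∈ entrySpan := by
  simp only [mulV_updateMatrix]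
  exact entrySpan.add_mem (entrySpan.smul_mem _ (hT _)) (entrySpan.smul_mem _ (hT _))

theorem mulV_predictMatrix_mem_entrySpan {x : ℤ → ℝ} {p s : ℕ} {T : (ℤ → ℝ) → ℤ → ℝ}
    (hT : ∀ k, (fun c => T c k) ∈ entrySpan) (k : ℤ) :
    (fun c => mulV (predictMatrix x p s) (T c) k) ∈ entrySpan := by
  simp only [mulV_predictMatrix]
  exact entrySpan.add_mem (entrySpan.smul_mem _ (hT _)) (entrySpan.smul_mem _ (hT _))

theorem unlift_mem_entrySpan (x : ℤ → ℝ) (p s : ℕ) {e o : (ℤ → ℝ) → ℤ → ℝ}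
    (he : ∀ k, (fun c => e c k) ∈ entrySpan) (ho : ∀ k, (fun c => o c k) ∈ entrySpan) (k : ℤ) :
    (fun c => (unlift x p s (e c) (o c)).1 k) ∈ entrySpan ∧
      (fun c => (unlift x p s (e c) (o c)).2 k) ∈ entrySpan := by
  induction s generalizing e o with
  | zero =>
    refine ⟨he k, ?_⟩
    simp only [unlift]
    split_ifs
    · exact entrySpan.add_mem (ho k) (mulV_predictMatrix_mem_entrySpan he k)
    · exact ho k
  | succ s ih =>
    have ho' : ∀ k, (fun c => (o c + mulV (predictMatrix x p (s + 1)) (e c)) k) ∈ entrySpan :=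
      fun k => entrySpan.add_mem (ho k) (mulV_predictMatrix_mem_entrySpan he k)
    exact ih (fun k => entrySpan.sub_mem (he k) (mulV_updateMatrix_mem_entrySpan ho' k)) ho'

theorem synthesis_eq_sum (x : ℤ → ℝ) (p : ℕ) (l : ℤ) :
    ∃ K : Finset ℤ, (∀ k, refinementMatrix x p l k ≠ 0 → k ∈ K) ∧
      ∀ c, synthesis x p c 0 l = ∑ k ∈ K, refinementMatrix x p l k * c k := by
  refine eq_finsum_of_mem_entrySpan (f := fun c => synthesis x p c 0 l) ?_
  have he : ∀ k, (fun c => mulV (scaleMatrix x p) c k) ∈ entrySpan := by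
    intro k
    simp only [mulV_scaleMatrix]
    exact entrySpan.smul_mem _ (Submodule.subset_span ⟨k, rfl⟩)
  have ho : ∀ k : ℤ, (fun _ : ℤ → ℝ => (0 : ℤ → ℝ) k) ∈ entrySpan := fun _ => entrySpan.zero_mem
  simp only [synthesis]
  split_ifs
  · exact (unlift_mem_entrySpan x p (numU p) he ho _).1
  · exact (unlift_mem_entrySpan x p (numU p) he ho _).2

/-! ### Columns of the refinement matrix -/

theorem evenFactor_congr {x y : ℤ → ℝ} {p s : ℕ} (hs : s ≤ numU p) {k : ℤ}
    (h : ∀ i, 2 * k - 2 * (numU p + numR p + s - 1) + par p ≤ i →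
      i ≤ 2 * k + 2 * (numU p + numR p + s - 1) → x i = y i) :
    evenFactor x p s k = evenFactor y p s k := by
  have h1 := numR_le_one p
  have h2 := par_nonneg p
  have h3 := par_le_one p
  induction s with
  | zero => rfl
  | succ s ih =>
    push_cast at h
    simp only [evenFactor, denU]
    congr 1
    · exact ih (by omega) fun i hi hi' => h i (by omega) (by omega)
    · congr 1 <;> congr 1 <;> refine h _ ?_ ?_ <;>
      · simp only [mIdx, tIdx, shiftU]; (try split_ifs) <;> omega

theorem oddFactor_congr {x y : ℤ → ℝ} {p i : ℕ} (hi : i ≤ numR p + numU p) {k : ℤ}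
    (h : ∀ l, 2 * k - 2 * (numU p + i - 1) + par p ≤ l → l ≤ 2 * k + 2 * (numU p + i) →
      x l = y l) :
    oddFactor x p i k = oddFactor y p i k := by
  have h1 := numR_le_one p
  have h2 := par_nonneg p
  have h3 := par_le_one p
  induction i with
  | zero => rfl
  | succ i ih =>
    push_cast at h
    simp only [oddFactor, denP]
    congr 1
    · exact ih (by omega) fun i hi hi' => h i (by omega) (by omega)
    · congr 1 <;> congr 1 <;> refine h _ ?_ ?_ <;>
      · simp only [mIdx, tIdx, shiftP]; (try split_ifs) <;> omega

/-- This zero and the one in `predictMatrix_zero_succ` reflect the one-sided first step for odd `p`.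
Without them the bounds on the support of a column would be too wide on the left. -/
theorem updateMatrix_one_self {p : ℕ} (hr : numR p = 0) (hp : par p = 1) (x : ℤ → ℝ) (k : ℤ) :
    updateMatrix x p 1 k k = 0 := by
  have hab : 2 * k - 2 * mIdx p 1 - 2 * tIdx p 1 + shiftU p 1 = 2 * k - 2 * mIdx p 1 - 1 := by
    simp [shiftU, mIdx, tIdx, hr, hp]; omega
  simp [updateMatrix, hab]

theorem predictMatrix_zero_succ {p : ℕ} (hr : numR p = 1) (hp : par p = 1) (x : ℤ → ℝ) (k : ℤ) :
    predictMatrix x p 0 k (k + 1) = 0 := by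
  have hab : 2 * k - 2 * mIdx p 0 - 2 * tIdx p 0 + shiftP p 0 = 2 * k - 2 * mIdx p 0 + 1 := by
    simp [shiftP, mIdx, tIdx, hr, hp]
  simp [predictMatrix, hab]

theorem updateMatrix_self_congr {x y : ℤ → ℝ} {p s : ℕ} (hs : s < numU p) {k : ℤ}
    (h : ∀ i, 2 * k - 2 * (numU p + numR p + s) + 2 * par p ≤ i →
      i ≤ 2 * k + 2 * (numU p + numR p + s) → x i = y i) :
    updateMatrix x p (s + 1) k k = updateMatrix y p (s + 1) k k := by
  have h1 := numR_le_one p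
  have h2 := par_nonneg p
  have h3 := par_le_one p
  -- In this case the formula mentions a knot just left of the allowed window, but the entry is zero
  -- for every knot sequence.
  by_cases hps : numR p = 0 ∧ s = 0 ∧ par p = 1
  · obtain ⟨hr, rfl, hp⟩ := hps
    rw [zero_add, updateMatrix_one_self hr hp, updateMatrix_one_self hr hp]
  · have e1 : numR p + (s + 1) - 1 = numR p + s := by omega
    simp only [updateMatrix, if_pos, denU, e1, Nat.add_sub_cancel]
    rw [evenFactor_congr (y := y) hs.le fun i hi hi' => h i (by omega) (by omega),
      oddFactor_congr (y := y) (by omega) fun i hi hi' => h i (by omega) (by omega)]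
    congr 1
    congr 1 <;> congr 1 <;> refine h _ ?_ ?_ <;>
    · simp only [mIdx, tIdx, shiftU]; (try split_ifs) <;> omega

theorem updateMatrix_pred_congr {x y : ℤ → ℝ} {p s : ℕ} (hs : s < numU p) {k : ℤ}
    (h : ∀ i, 2 * k - 2 * (numU p + numR p + s) + par p ≤ i →
      i ≤ 2 * k + 2 * (numU p + numR p + s) → x i = y i) :
    updateMatrix x p (s + 1) k (k - 1) = updateMatrix y p (s + 1) k (k - 1) := by
  have h1 := numR_le_one p
  have h2 := par_nonneg p
  have h3 := par_le_one p
  have e1 : numR p + (s + 1) - 1 = numR p + s := by omega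
  have hne : k - 1 ≠ k := by omega
  simp only [updateMatrix, if_pos, hne, if_false, denU, e1, Nat.add_sub_cancel]
  rw [evenFactor_congr (y := y) hs.le fun i hi hi' => h i (by omega) (by omega),
    oddFactor_congr (y := y) (by omega) fun i hi hi' => h i (by omega) (by omega)]
  congr 1
  congr 1 <;> congr 1 <;> refine h _ ?_ ?_ <;>
  · simp only [mIdx, tIdx, shiftU]; (try split_ifs) <;> omega

theorem predictMatrix_self_congr {x y : ℤ → ℝ} {p s : ℕ} (hs : s ≤ numU p) (hrs : 1 ≤ numR p + s)
    {k : ℤ} (h : ∀ i, 2 * k - 2 * (numU p + numR p + s - 1) + par p ≤ i →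
      i ≤ 2 * k + 2 * (numU p + numR p + s) → x i = y i) :
    predictMatrix x p s k k = predictMatrix y p s k k := by
  have h1 := numR_le_one p
  have h2 := par_nonneg p
  have h3 := par_le_one p
  simp only [predictMatrix, if_pos, denP]
  rw [evenFactor_congr (y := y) hs fun i hi hi' => h i (by omega) (by omega),
    oddFactor_congr (y := y) (by omega) fun i hi hi' => h i (by omega) (by omega)]
  congr 1
  congr 1 <;> congr 1 <;> refine h _ ?_ ?_ <;>
  · simp only [mIdx, tIdx, shiftP]; (try split_ifs) <;> omega

theorem predictMatrix_succ_congr {x y : ℤ → ℝ} {p s : ℕ} (hs : s ≤ numU p) (hrs : 1 ≤ numR p + s)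
    {k : ℤ} (h : ∀ i, 2 * k - 2 * (numU p + numR p + s - 1) + 2 * par p ≤ i →
      i ≤ 2 * k + 2 * (numU p + numR p + s) → x i = y i) :
    predictMatrix x p s k (k + 1) = predictMatrix y p s k (k + 1) := by
  have h1 := numR_le_one p
  have h2 := par_nonneg p
  have h3 := par_le_one p
  by_cases hps : s = 0 ∧ par p = 1
  · obtain ⟨rfl, hp⟩ := hps
    rw [predictMatrix_zero_succ (by omega) hp, predictMatrix_zero_succ (by omega) hp]
  · have hne : k + 1 ≠ k := by omega
    simp only [predictMatrix, if_pos, hne, if_false, denP]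
    rw [evenFactor_congr (y := y) hs fun i hi hi' => h i (by omega) (by omega),
      oddFactor_congr (y := y) (by omega) fun i hi hi' => h i (by omega) (by omega)]
    congr 1
    congr 1 <;> congr 1 <;> refine h _ ?_ ?_ <;>
    · simp only [mIdx, tIdx, shiftP]; (try split_ifs) <;> omega

theorem mulV_predictMatrix_congr {x y : ℤ → ℝ} {p s : ℕ} (hs : s ≤ numU p)
    (hrs : 1 ≤ numR p + s) {k₀ : ℤ}
    (hxy : ∀ i, 2 * leftIdx p k₀ ≤ i → i ≤ 2 * rightIdx p k₀ → x i = y i) {e : ℤ → ℝ}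
    (he : ∀ i, e i ≠ 0 → k₀ - (numU p - s) ≤ i ∧ i ≤ k₀ + (numU p - s)) :
    mulV (predictMatrix x p s) e = mulV (predictMatrix y p s) e := by
  have h2 := par_nonneg p
  have h3 := par_le_one p
  have h4 := half_add_par p
  simp only [leftIdx, rightIdx_eq] at hxy
  ext i
  rw [mulV_predictMatrix, mulV_predictMatrix]
  congr 1
  · by_cases h : e i = 0
    · rw [h, mul_zero, mul_zero]
    · have := he i h
      rw [predictMatrix_self_congr hs hrs fun l hl hl' => hxy l (by omega) (by omega)]
  · by_cases h : e (i + 1) = 0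
    · rw [h, mul_zero, mul_zero]
    · have := he _ h
      rw [predictMatrix_succ_congr hs hrs fun l hl hl' => hxy l (by omega) (by omega)]

theorem mulV_updateMatrix_congr {x y : ℤ → ℝ} {p s : ℕ} (hs : s < numU p) {k₀ : ℤ}
    (hxy : ∀ i, 2 * leftIdx p k₀ ≤ i → i ≤ 2 * rightIdx p k₀ → x i = y i) {o : ℤ → ℝ}
    (ho : ∀ i, o i ≠ 0 → k₀ - (numU p - s) ≤ i ∧ i < k₀ + (numU p - s)) :
    mulV (updateMatrix x p (s + 1)) o = mulV (updateMatrix y p (s + 1)) o := by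
  have h2 := par_nonneg p
  have h3 := par_le_one p
  have h4 := half_add_par p
  simp only [leftIdx, rightIdx_eq] at hxy
  ext i
  rw [mulV_updateMatrix, mulV_updateMatrix]
  congr 1
  · by_cases h : o i = 0
    · rw [h, mul_zero, mul_zero]
    · have := ho i h
      rw [updateMatrix_self_congr hs fun l hl hl' => hxy l (by omega) (by omega)]
  · by_cases h : o (i - 1) = 0
    · rw [h, mul_zero, mul_zero]
    · have := ho _ h
      rw [updateMatrix_pred_congr hs fun l hl hl' => hxy l (by omega) (by omega)]

theorem mulV_predictMatrix_ne_zero {x : ℤ → ℝ} {p s : ℕ} {e : ℤ → ℝ} {i : ℤ}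
    (h : mulV (predictMatrix x p s) e i ≠ 0) :
    e i ≠ 0 ∨ (predictMatrix x p s i (i + 1) ≠ 0 ∧ e (i + 1) ≠ 0) := by
  rw [mulV_predictMatrix] at h
  by_contra! hn
  obtain ⟨h1, h2⟩ := hn
  apply h
  by_cases h3 : predictMatrix x p s i (i + 1) = 0
  · rw [h1, h3]; ring
  · rw [h1, h2 h3]; ring

theorem mulV_updateMatrix_ne_zero {x : ℤ → ℝ} {p s : ℕ} {o : ℤ → ℝ} {i : ℤ}
    (h : mulV (updateMatrix x p s) o i ≠ 0) :
    (updateMatrix x p s i i ≠ 0 ∧ o i ≠ 0) ∨ o (i - 1) ≠ 0 := by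
  rw [mulV_updateMatrix] at h
  by_contra! hn
  obtain ⟨h1, h2⟩ := hn
  apply h
  by_cases h3 : updateMatrix x p s i i = 0
  · rw [h2, h3]; ring
  · rw [h1 h3, h2]; ring

theorem add_ne_zero_or {a b : ℝ} (h : a + b ≠ 0) : a ≠ 0 ∨ b ≠ 0 := by
  by_contra! hn
  exact h (by rw [hn.1, hn.2, add_zero])

/-- The induction runs through the inverse scheme, with `s` counting the pairs still to be undone.
Supports widen by one index per pair, and within them the matrices read only knots of the coarse
support. The extra left bound on `e` is not implied by the radius when `p` is odd and `r = 0`. -/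
theorem unlift_congr {x y : ℤ → ℝ} {p : ℕ} {k₀ : ℤ}
    (hxy : ∀ i, 2 * leftIdx p k₀ ≤ i → i ≤ 2 * rightIdx p k₀ → x i = y i) {s : ℕ}
    (hs : s ≤ numU p) {e o : ℤ → ℝ}
    (he : ∀ i, e i ≠ 0 → k₀ - (numU p - s) ≤ i ∧ i ≤ k₀ + (numU p - s) ∧
      leftIdx p (2 * k₀) ≤ 2 * i)
    (ho : ∀ i, o i ≠ 0 → k₀ - (numU p - s) ≤ i ∧ i < k₀ + (numU p - s)) :
    unlift x p s e o = unlift y p s e o ∧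
      (∀ i, (unlift x p s e o).1 i ≠ 0 →
        leftIdx p (2 * k₀) ≤ 2 * i ∧ 2 * i ≤ rightIdx p (2 * k₀)) ∧
      (∀ i, (unlift x p s e o).2 i ≠ 0 →
        leftIdx p (2 * k₀) ≤ 2 * i + 1 ∧ 2 * i + 1 ≤ rightIdx p (2 * k₀)) := by
  have h1 := numR_le_one p
  have h2 := par_nonneg p
  have h3 := par_le_one p
  have h4 := half_add_par p
  induction s generalizing e o with
  | zero =>
    by_cases hr : numR p = 1
    · simp only [unlift, if_pos hr]
      refine ⟨?_, ?_, ?_⟩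
      · rw [mulV_predictMatrix_congr (y := y) hs (by omega) hxy
          fun i hi => ⟨(he i hi).1, (he i hi).2.1⟩]
      · intro i hi
        have := he i hi
        simp only [leftIdx, rightIdx_eq] at this ⊢
        omega
      · intro i hi
        simp only [leftIdx, rightIdx_eq] at he ⊢
        rcases add_ne_zero_or hi with hi | hi
        · have := ho i hi
          omega
        · rcases mulV_predictMatrix_ne_zero hi with hi | ⟨hi, hi'⟩
          · have := he i hi
            omega
          · have := he _ hi'
            obtain hp | hp : par p = 0 ∨ par p = 1 := by omega
            · omega
            · exact absurd (predictMatrix_zero_succ hr hp x i) hi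
    · simp only [unlift, if_neg hr]
      refine ⟨trivial, ?_, ?_⟩
      · intro i hi
        have := he i hi
        simp only [leftIdx, rightIdx_eq] at this ⊢
        omega
      · intro i hi
        have := ho i hi
        simp only [leftIdx, rightIdx_eq]
        omega
  | succ s ih =>
    have hP := mulV_predictMatrix_congr (y := y) hs (by omega) hxy
      fun i hi => ⟨(he i hi).1, (he i hi).2.1⟩
    set o' := o + mulV (predictMatrix x p (s + 1)) e with ho'
    have hos : ∀ i, o' i ≠ 0 → k₀ - (numU p - s) ≤ i ∧ i < k₀ + (numU p - s) := by
      intro i hi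
      push_cast at he ho
      rcases add_ne_zero_or hi with hi | hi
      · have := ho i hi
        omega
      · rcases mulV_predictMatrix_ne_zero hi with hi | ⟨-, hi⟩
        · have := he _ hi
          omega
        · have := he _ hi
          omega
    have hU := mulV_updateMatrix_congr (y := y) (by omega) hxy hos
    have hes : ∀ i, (e - mulV (updateMatrix x p (s + 1)) o') i ≠ 0 →
        k₀ - (numU p - s) ≤ i ∧ i ≤ k₀ + (numU p - s) ∧ leftIdx p (2 * k₀) ≤ 2 * i := by
      intro i hi
      push_cast at he
      simp only [leftIdx] at he ⊢
      rw [Pi.sub_apply, sub_eq_add_neg] at hi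
      rcases add_ne_zero_or hi with hi | hi
      · have := he _ hi
        omega
      · rcases mulV_updateMatrix_ne_zero (neg_ne_zero.mp hi) with ⟨hi, hi'⟩ | hi
        · have := hos _ hi'
          -- Only here could the support pass the left bound; the diagonal of the first update
          -- matrix is zero in this case.
          by_cases hps : numR p = 0 ∧ s = 0 ∧ par p = 1
          · obtain ⟨hr, rfl, hp⟩ := hps
            exact absurd (updateMatrix_one_self hr hp x i) hi
          · omega
        · have := hos _ hi
          omega
    have key := ih (by omega) hes hos
    have e1 : unlift y p (s + 1) e o
        = unlift y p s (e - mulV (updateMatrix x p (s + 1)) o') o' := by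
      simp only [unlift]
      rw [← hP, ← ho', ← hU]
    rw [e1]
    exact key

/-- Locality of a column in two senses: the knots it reads and the `p + 1` rows in which it can be
nonzero. With `x = y` it serves as a pure support statement. -/
theorem refinementMatrix_congr {x y : ℤ → ℝ} {p : ℕ} (hp : 1 ≤ p) {k : ℤ}
    (hxy : ∀ i, 2 * leftIdx p k ≤ i → i ≤ 2 * rightIdx p k → x i = y i) (l : ℤ) :
    refinementMatrix x p l k = refinementMatrix y p l k ∧
      (refinementMatrix x p l k ≠ 0 →
        leftIdx p (2 * k) ≤ l ∧ l ≤ rightIdx p (2 * k)) := by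
  have h1 := numR_le_one p
  have h2 := par_nonneg p
  have h3 := par_le_one p
  have h4 := half_add_par p
  have h5 := two_mul_half_add_par p
  have hD : mulV (scaleMatrix x p) (Pi.single k 1) = mulV (scaleMatrix y p) (Pi.single k 1) := by
    ext i
    rw [mulV_scaleMatrix, mulV_scaleMatrix]
    by_cases hi : i = k
    · subst hi
      rw [evenFactor_congr le_rfl fun l hl hl' => hxy l (by simp only [leftIdx]; omega)
        (by simp only [rightIdx_eq]; omega)]
    · simp [hi]
  obtain ⟨h6, h7, h8⟩ := unlift_congr (y := y) hxy (le_refl (numU p))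
    (e := mulV (scaleMatrix x p) (Pi.single k 1)) (o := 0)
    (fun i hi => by
      have hik : i = k := by
        by_contra h
        exact hi (by rw [mulV_scaleMatrix]; simp [h])
      simp only [leftIdx]
      omega)
    (fun i hi => absurd rfl hi)
  simp only [refinementMatrix, synthesis]
  rw [← hD, ← h6]
  refine ⟨rfl, ?_⟩
  split_ifs with hl
  · intro h
    have := h7 _ h
    have := Int.even_iff.mp hl
    omega
  · intro h
    have := h8 _ h
    have := Int.not_even_iff.mp hl
    omega

/-! ### B-splines on a knot grid -/

/-- The canonical power coefficients. -/
noncomputable def powerCoeff (x : ℤ → ℝ) (p q : ℕ) (k : ℤ) : ℝ :=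
  powerFunctional (p - 1) q (knotPoly x (Finset.Ioc (leftIdx p k) (rightIdx p k - 1)))

/-- The indices of the B-splines that live on the knot interval number `i`. -/
noncomputable def activeSet (p : ℕ) (i : ℤ) : Finset ℤ :=
  Finset.Icc (i - p + 1 + (p / 2 : ℕ)) (i + (p / 2 : ℕ))

theorem mem_activeSet {p : ℕ} {i k : ℤ} :
    k ∈ activeSet p i ↔ leftIdx p k ≤ i ∧ i < rightIdx p k := by
  rw [activeSet, Finset.mem_Icc, rightIdx_eq_leftIdx_add, leftIdx]; omega

theorem sum_activeSet (n : ℕ) (i : ℤ) (f : ℤ → ℝ) :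
    ∑ k ∈ activeSet (n + 1) i, f k
      = ∑ m ∈ Finset.range (n + 1), f (i - n + m + ((n + 1) / 2 : ℕ)) := by
  symm
  refine Finset.sum_bij (fun m _ => i - n + m + ((n + 1) / 2 : ℕ)) ?_ ?_ ?_ fun _ _ => rfl
  · intro m hm
    have := Finset.mem_range.mp hm
    rw [activeSet, Finset.mem_Icc]; omega
  · intro m _ m' _ h
    omega
  · intro k hk
    rw [activeSet, Finset.mem_Icc] at hk
    exact ⟨(k - (i - n + ((n + 1) / 2 : ℕ))).toNat, Finset.mem_range.mpr (by omega), by omega⟩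

theorem bspline_congr {x y : ℤ → ℝ} {n : ℕ} {k : ℤ}
    (h : ∀ i, leftIdx (n + 1) k ≤ i → i ≤ rightIdx (n + 1) k → x i = y i) (t : ℝ) :
    bspline x (n + 1) k t = bspline y (n + 1) k t := by
  rw [bspline_eq_coxDeBoor, bspline_eq_coxDeBoor]
  rw [rightIdx_eq_leftIdx_add] at h
  exact coxDeBoor_congr (fun i hi => h i hi.1 (by have := hi.2; push_cast; omega)) t

theorem knotPoly_congr {x y : ℤ → ℝ} {S : Finset ℤ} (h : ∀ i ∈ S, x i = y i) :
    knotPoly x S = knotPoly y S :=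
  Finset.prod_congr rfl fun i hi => by rw [h i hi]

theorem leftIdx_add_half (n : ℕ) (j : ℤ) : leftIdx (n + 1) (j + ((n + 1) / 2 : ℕ)) = j := by
  unfold leftIdx; omega

theorem powerCoeff_add_half (x : ℤ → ℝ) (n q : ℕ) (j : ℤ) :
    powerCoeff x (n + 1) q (j + ((n + 1) / 2 : ℕ))
      = powerFunctional n q (knotPoly x (Finset.Ioc j (j + n))) := by
  rw [powerCoeff, rightIdx_eq_leftIdx_add, leftIdx_add_half]
  have e : j + ((n + 1 : ℕ) : ℤ) - 1 = j + n := by omega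
  rw [e, Nat.add_sub_cancel]

namespace KnotGrid

variable {G : KnotGrid} {n : ℕ} {i k : ℤ} {t : ℝ}

theorem strictMonoOn_Icc (G : KnotGrid) {a b : ℤ} (ha : a ∈ G.idx) (hb : b ∈ G.idx) :
    StrictMonoOn G.knot (Set.Icc a b) :=
  G.strictMonoOn.mono (G.ordConnected.out ha hb)

theorem bspline_eq_zero (hk : k ∈ G.inner (n + 1)) (ht : t ∉ G.supp (n + 1) k) :
    bspline G.knot (n + 1) k t = 0 := by
  have e : leftIdx (n + 1) k + n + 1 = rightIdx (n + 1) k := by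
    rw [rightIdx_eq_leftIdx_add]; push_cast; ring
  rw [bspline_eq_coxDeBoor]
  refine coxDeBoor_eq_zero ?_ ?_
  · rw [e]; exact G.strictMonoOn_Icc hk.1 hk.2
  · rwa [e]

theorem mem_inner_of_mem_activeSet (h1 : i - (n + 1 : ℕ) + 1 ∈ G.idx) (h2 : i + (n + 1 : ℕ) ∈ G.idx)
    (hk : k ∈ activeSet (n + 1) i) : k ∈ G.inner (n + 1) := by
  rw [mem_activeSet, rightIdx_eq_leftIdx_add] at hk
  refine ⟨G.ordConnected.out h1 h2 ⟨by omega, by omega⟩,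
    G.ordConnected.out h1 h2 ⟨?_, ?_⟩⟩ <;> rw [rightIdx_eq_leftIdx_add] <;> omega

theorem mem_activeSet_of_mem_supp (h1 : i ∈ G.idx) (h2 : i + 1 ∈ G.idx)
    (ht : t ∈ Set.Ico (G.knot i) (G.knot (i + 1))) (hk : k ∈ G.inner (n + 1))
    (hs : t ∈ G.supp (n + 1) k) : k ∈ activeSet (n + 1) i := by
  rw [mem_activeSet]
  have h3 := (G.strictMonoOn.lt_iff_lt hk.1 h2).mp (hs.1.trans_lt ht.2)
  have h4 := (G.strictMonoOn.lt_iff_lt h1 hk.2).mp (ht.1.trans_lt hs.2)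
  omega

theorem mem_idx_of_window (h1 : i - (n + 1 : ℕ) + 1 ∈ G.idx) (h2 : i + (n + 1 : ℕ) ∈ G.idx) :
    i ∈ G.idx ∧ i + 1 ∈ G.idx :=
  ⟨G.ordConnected.out h1 h2 ⟨by omega, by omega⟩, G.ordConnected.out h1 h2 ⟨by omega, by omega⟩⟩

theorem strictMonoOn_window (h1 : i - (n + 1 : ℕ) + 1 ∈ G.idx) (h2 : i + (n + 1 : ℕ) ∈ G.idx) :
    StrictMonoOn G.knot (Set.Icc (i - n) (i + n + 1)) :=
  (G.strictMonoOn_Icc h1 h2).mono (Set.Icc_subset_Icc (by omega) (by omega))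

/-- On an interior knot interval only the `p` active indices contribute, and all of them are inner.
The values `v` are general so that this covers both B-splines and candidate solutions. -/
theorem finsum_inner_eq (h1 : i - (n + 1 : ℕ) + 1 ∈ G.idx) (h2 : i + (n + 1 : ℕ) ∈ G.idx)
    (ht : t ∈ Set.Ico (G.knot i) (G.knot (i + 1))) {a v : ℤ → ℝ}
    (hv : ∀ k ∈ G.inner (n + 1), t ∉ G.supp (n + 1) k → v k = 0) :
    ∑ᶠ k ∈ G.inner (n + 1), a k * v k = ∑ k ∈ activeSet (n + 1) i, a k * v k := by
  refine finsum_mem_eq_sum_of_inter_support_eq _ (Set.ext fun k => ?_)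
  simp only [Set.mem_inter_iff, Function.mem_support, Finset.mem_coe]
  refine and_congr_left fun hne => ⟨fun hk => ?_, mem_inner_of_mem_activeSet h1 h2⟩
  obtain ⟨h3, h4⟩ := mem_idx_of_window h1 h2
  by_contra hk'
  exact right_ne_zero_of_mul hne
    (hv k hk fun hs => hk' (mem_activeSet_of_mem_supp h3 h4 ht hk hs))

theorem sum_activeSet_powerCoeff (h1 : i - (n + 1 : ℕ) + 1 ∈ G.idx) (h2 : i + (n + 1 : ℕ) ∈ G.idx)
    (ht : t ∈ Set.Ico (G.knot i) (G.knot (i + 1))) {q : ℕ} (hq : q ≤ n) :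
    ∑ k ∈ activeSet (n + 1) i, powerCoeff G.knot (n + 1) q k * bspline G.knot (n + 1) k t
      = t ^ q := by
  rw [sum_activeSet, ← sum_powerFunctional_mul_coxDeBoor hq (strictMonoOn_window h1 h2) ht]
  refine Finset.sum_congr rfl fun m _ => ?_
  rw [powerCoeff_add_half, bspline_eq_coxDeBoor, leftIdx_add_half]

theorem isPowerCoeffs_powerCoeff (G : KnotGrid) {q : ℕ} (hq : q ≤ n) :
    IsPowerCoeffs G (n + 1) q (powerCoeff G.knot (n + 1) q) := by
  rintro t ⟨i, h1, h2, h3, h4⟩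
  rw [finsum_inner_eq h1 h2 ⟨h3, h4⟩ fun k hk hs => bspline_eq_zero hk hs,
    sum_activeSet_powerCoeff h1 h2 ⟨h3, h4⟩ hq]

/-- An interior interval that misses the support of the B-spline can be replaced by the first or the
last knot interval of that support: the knots of the B-spline supply one end of the new window, and
convexity of the index set the other. -/
theorem exists_active_window (hG : (G.interior (n + 1)).Nonempty) (hk : k ∈ G.inner (n + 1)) :
    ∃ i : ℤ, i - (n + 1 : ℕ) + 1 ∈ G.idx ∧ i + (n + 1 : ℕ) ∈ G.idx ∧ k ∈ activeSet (n + 1) i := by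
  obtain ⟨t, i, h1, h2, -, -⟩ := hG
  obtain ⟨h3, h4⟩ := hk
  have e := rightIdx_eq_leftIdx_add (n + 1) k
  simp only [mem_activeSet]
  rcases lt_or_ge i (leftIdx (n + 1) k) with h | h
  · refine ⟨leftIdx (n + 1) k, G.ordConnected.out h1 h3 ⟨by omega, by omega⟩, ?_, by omega⟩
    rwa [← e]
  · rcases lt_or_ge i (rightIdx (n + 1) k) with h' | h'
    · exact ⟨i, h1, h2, h, h'⟩
    · refine ⟨rightIdx (n + 1) k - 1, ?_, G.ordConnected.out h4 h2 ⟨by omega, by omega⟩, by omega⟩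
      have e' : rightIdx (n + 1) k - 1 - (n + 1 : ℕ) + 1 = leftIdx (n + 1) k := by omega
      rwa [e']

/-- Local linear independence on an interior knot interval where the B-spline `k` is active. -/
theorem eq_powerCoeff (hG : (G.interior (n + 1)).Nonempty) {q : ℕ} (hq : q ≤ n) {a : ℤ → ℝ}
    (ha : IsPowerCoeffs G (n + 1) q a) (hk : k ∈ G.inner (n + 1)) :
    a k = powerCoeff G.knot (n + 1) q k := by
  obtain ⟨i, h1, h2, hki⟩ := exists_active_window hG hk
  rw [mem_activeSet, rightIdx_eq_leftIdx_add] at hki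
  have key := eq_zero_of_sum_mul_coxDeBoor_eq_zero (strictMonoOn_window h1 h2)
    (b := fun j => a (j + ((n + 1) / 2 : ℕ)) - powerCoeff G.knot (n + 1) q (j + ((n + 1) / 2 : ℕ)))
    (fun t ht => by
      have h3 := ha t ⟨i, h1, h2, ht.1, ht.2⟩
      rw [finsum_inner_eq h1 h2 ht fun k hk hs => bspline_eq_zero hk hs,
        ← sum_activeSet_powerCoeff h1 h2 ht hq, ← sub_eq_zero, ← Finset.sum_sub_distrib,
        sum_activeSet] at h3
      rw [← h3]
      refine Finset.sum_congr rfl fun m _ => ?_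
      rw [bspline_eq_coxDeBoor, leftIdx_add_half, sub_mul])
    (j := leftIdx (n + 1) k) (by omega) (by omega)
  have e : leftIdx (n + 1) k + ((n + 1) / 2 : ℕ) = k := by unfold leftIdx; omega
  simp only [e] at key
  linarith

/-- Values that vanish off the supports of the B-splines and combine with the power coefficients to
the power functions are the values of the B-splines. -/
theorem eq_bspline (ht : t ∈ G.interior (n + 1)) {v : ℤ → ℝ}
    (hv : ∀ k ∈ G.inner (n + 1), t ∉ G.supp (n + 1) k → v k = 0)
    (hsum : ∀ q ≤ n, ∑ᶠ k ∈ G.inner (n + 1), powerCoeff G.knot (n + 1) q k * v k = t ^ q)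
    (hk : k ∈ G.inner (n + 1)) : v k = bspline G.knot (n + 1) k t := by
  obtain ⟨i, h1, h2, h3, h4⟩ := ht
  by_cases hs : t ∈ G.supp (n + 1) k
  · obtain ⟨h5, h6⟩ := mem_idx_of_window h1 h2
    have hki := mem_activeSet_of_mem_supp h5 h6 ⟨h3, h4⟩ hk hs
    rw [mem_activeSet, rightIdx_eq_leftIdx_add] at hki
    have key := eq_zero_of_sum_powerFunctional_mul_eq_zero (strictMonoOn_window h1 h2)
      (v := fun j => v (j + ((n + 1) / 2 : ℕ)) - bspline G.knot (n + 1) (j + ((n + 1) / 2 : ℕ)) t)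
      (fun q hq => by
        have h7 := hsum q hq
        rw [finsum_inner_eq h1 h2 ⟨h3, h4⟩ hv,
          ← sum_activeSet_powerCoeff h1 h2 ⟨h3, h4⟩ hq, ← sub_eq_zero, ← Finset.sum_sub_distrib,
          sum_activeSet] at h7
        rw [← h7]
        refine Finset.sum_congr rfl fun m _ => ?_
        rw [powerCoeff_add_half, mul_sub])
      (j := leftIdx (n + 1) k) (by omega) (by omega)
    have e : leftIdx (n + 1) k + ((n + 1) / 2 : ℕ) = k := by unfold leftIdx; omega
    simp only [e] at key
    linarith
  · rw [hv k hk hs, bspline_eq_zero hk hs]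

theorem interior_nonempty (h1 : i - (n + 1 : ℕ) + 1 ∈ G.idx) (h2 : i + (n + 1 : ℕ) ∈ G.idx) :
    (G.interior (n + 1)).Nonempty := by
  obtain ⟨h3, h4⟩ := mem_idx_of_window h1 h2
  exact ⟨G.knot i, i, h1, h2, le_rfl, G.strictMonoOn h3 h4 (by omega)⟩

end KnotGrid

/-! ### Comparison of nested grids -/

theorem exists_knot_interval {x : ℤ → ℝ} {a b : ℤ} {t : ℝ} (hab : a ≤ b)
    (ht : t ∈ Set.Ico (x a) (x b)) : ∃ i, a ≤ i ∧ i < b ∧ t ∈ Set.Ico (x i) (x (i + 1)) := by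
  induction b, hab using Int.leInduction with
  | base => exact absurd (ht.1.trans_lt ht.2) (lt_irrefl _)
  | succ b hb ih =>
    rcases lt_or_ge t (x b) with h | h
    · obtain ⟨i, h1, h2, h3⟩ := ih ⟨ht.1, h⟩
      exact ⟨i, h1, by omega, h3⟩
    · exact ⟨b, hb, by omega, h, ht.2⟩

theorem TwoNested.interior_subset {fine coarse : KnotGrid} (h : TwoNested fine coarse) (n : ℕ) :
    coarse.interior (n + 1) ⊆ fine.interior (n + 1) := by
  rintro t ⟨i, h1, h2, h3, h4⟩
  obtain ⟨h5, h6⟩ := KnotGrid.mem_idx_of_window h1 h2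
  rw [← (h _ h5).2] at h3
  rw [← (h _ h6).2] at h4
  obtain ⟨j, h7, h8, h9⟩ := exists_knot_interval (by omega) (⟨h3, h4⟩ : t ∈ Set.Ico _ _)
  have hl := (h _ h1).1
  have hr := (h _ h2).1
  exact ⟨j, fine.ordConnected.out hl hr ⟨by omega, by omega⟩,
    fine.ordConnected.out hl hr ⟨by omega, by omega⟩, h9.1, h9.2⟩

theorem TwoNested.knot_eq {fine coarse : KnotGrid} (h : TwoNested fine coarse) {p : ℕ} {k : ℤ}
    (hk : k ∈ coarse.inner p) {i : ℤ} (h1 : leftIdx p k ≤ i) (h2 : i ≤ rightIdx p k) :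
    coarse.knot i = fine.knot (2 * i) :=
  ((h i (coarse.ordConnected.out hk.1 hk.2 ⟨h1, h2⟩)).2).symm

theorem TwoNested.mem_inner {fine coarse : KnotGrid} (h : TwoNested fine coarse) {p : ℕ} {k l : ℤ}
    (hk : k ∈ coarse.inner p) (h1 : leftIdx p (2 * k) ≤ l) (h2 : l ≤ rightIdx p (2 * k)) :
    l ∈ fine.inner p := by
  have hl := (h _ hk.1).1
  have hr := (h _ hk.2).1
  simp only [leftIdx, rightIdx] at h1 h2 hl hr
  refine ⟨fine.ordConnected.out hl hr ⟨?_, ?_⟩, fine.ordConnected.out hl hr ⟨?_, ?_⟩⟩ <;>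
    simp only [leftIdx, rightIdx] <;> omega

/-! ### The refinement equation -/

/-- The bi-infinite grid of a strictly increasing sequence of knots. -/
def univGrid (x : ℤ → ℝ) (hx : StrictMono x) : KnotGrid where
  idx := Set.univ
  ordConnected := Set.ordConnected_univ
  knot := x
  strictMonoOn := hx.strictMonoOn _

theorem mem_inner_univGrid {x : ℤ → ℝ} (hx : StrictMono x) (p : ℕ) (k : ℤ) :
    k ∈ (univGrid x hx).inner p := ⟨Set.mem_univ _, Set.mem_univ _⟩

theorem strictMono_coarse {x : ℤ → ℝ} (hx : StrictMono x) : StrictMono fun i => x (2 * i) :=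
  fun _ _ h => hx (by omega)

theorem synthesis_powerCoeff {x : ℤ → ℝ} (hx : StrictMono x) (n q : ℕ) (l : ℤ) :
    synthesis x (n + 1) (powerCoeff (fun i => x (2 * i)) (n + 1) q) 0 l
      = powerCoeff x (n + 1) q l := by
  have h1 : coarseCoeff x (n + 1) (powerCoeff x (n + 1) q)
      = powerCoeff (fun i => x (2 * i)) (n + 1) q :=
    funext fun k => coarseCoeff_eq _ (by omega) Set.ordConnected_univ (hx.strictMonoOn _)
      (fun _ _ _ => rfl) (Set.mem_univ _) (Set.mem_univ _)
  rw [← h1]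
  exact synthesis_coarseCoeff (fun k => evenFactor_ne_zero le_rfl (hx.strictMonoOn _))
    (fun k => detailCoeff_eq_zero _ (by omega) Set.ordConnected_univ (hx.strictMonoOn _)
      (fun _ _ _ => rfl) (Set.mem_univ _) (Set.mem_univ _)) l

/-- The right-hand sides `ψ k` satisfy the hypotheses of `KnotGrid.eq_bspline` on the coarse grid,
which characterize the B-splines there. -/
theorem refinement_of_strictMono {x : ℤ → ℝ} (hx : StrictMono x) (n : ℕ) (k : ℤ) (t : ℝ) :
    bspline (fun i => x (2 * i)) (n + 1) k t
      = ∑ᶠ l : ℤ, refinementMatrix x (n + 1) l k * bspline x (n + 1) l t := by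
  set F := univGrid x hx with hF
  set G := univGrid (fun i => x (2 * i)) (strictMono_coarse hx) with hG
  set ψ : ℤ → ℝ := fun k => ∑ᶠ l : ℤ, refinementMatrix x (n + 1) l k * bspline x (n + 1) l t with hψ
  have hFin : ∀ l, l ∈ F.inner (n + 1) := mem_inner_univGrid hx (n + 1)
  have hGin : ∀ l, l ∈ G.inner (n + 1) := mem_inner_univGrid (strictMono_coarse hx) (n + 1)
  have hsupp : ∀ k ∈ G.inner (n + 1), t ∉ G.supp (n + 1) k → ψ k = 0 := by
    intro k _ hk
    refine finsum_eq_zero_of_forall_eq_zero fun l => ?_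
    by_cases hl : refinementMatrix x (n + 1) l k = 0
    · rw [hl, zero_mul]
    · have h := (refinementMatrix_congr (x := x) (y := x) (by omega) (fun _ _ _ => rfl) l).2 hl
      have h0 : bspline x (n + 1) l t = 0 := by
        refine KnotGrid.bspline_eq_zero (hFin l) fun hs => hk ?_
        refine ⟨le_trans (hx.monotone ?_) hs.1, hs.2.trans_le (hx.monotone ?_)⟩ <;>
        · simp only [leftIdx, rightIdx] at h ⊢; omega
      rw [h0, mul_zero]
  change _ = ψ k
  by_cases hk : t ∈ G.supp (n + 1) k
  swap
  · rw [hsupp k (hGin k) hk]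
    exact KnotGrid.bspline_eq_zero (hGin k) hk
  have hGt : t ∈ G.interior (n + 1) := by
    obtain ⟨i, -, -, h⟩ := exists_knot_interval (by simp only [leftIdx, rightIdx]; omega) hk
    exact ⟨i, Set.mem_univ _, Set.mem_univ _, h.1, h.2⟩
  have hnest : TwoNested F G := fun _ _ => ⟨Set.mem_univ _, rfl⟩
  obtain ⟨j, h1, h2, h3, h4⟩ := hnest.interior_subset n hGt
  set S := activeSet (n + 1) j with hS
  have hzero : ∀ l, l ∉ S → bspline x (n + 1) l t = 0 := fun l hl =>
    KnotGrid.bspline_eq_zero (hFin l) fun hs => hl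
      (KnotGrid.mem_activeSet_of_mem_supp (G := F) (Set.mem_univ _) (Set.mem_univ _) ⟨h3, h4⟩
        (hFin l) hs)
  have hψS : ∀ k, ψ k = ∑ l ∈ S, refinementMatrix x (n + 1) l k * bspline x (n + 1) l t := by
    intro k
    refine finsum_eq_sum_of_support_subset _ fun l hl => ?_
    by_contra hlS
    exact hl (by simp only [hzero l hlS, mul_zero])
  -- Finite row supports `K l`, united over the finitely many fine B-splines active at `t`, turn the
  -- double sum over `k` and `l` into a finite one that can be interchanged.
  choose K hK hKsum using synthesis_eq_sum x (n + 1)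
  refine (KnotGrid.eq_bspline hGt hsupp (fun q hq => ?_) (hGin k)).symm
  have hfine := KnotGrid.sum_activeSet_powerCoeff h1 h2 ⟨h3, h4⟩ hq
  set T := S.biUnion K with hT
  -- The refinement matrix maps coarse power coefficients to fine ones.
  have hrow : ∀ l ∈ S, powerCoeff x (n + 1) q l = ∑ k ∈ T,
      refinementMatrix x (n + 1) l k * powerCoeff (fun i => x (2 * i)) (n + 1) q k := by
    intro l hl
    rw [← synthesis_powerCoeff hx, hKsum]
    refine Finset.sum_subset (Finset.subset_biUnion_of_mem K hl) fun k _ hk => ?_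
    by_contra hne
    exact hk (hK l k (left_ne_zero_of_mul hne))
  calc ∑ᶠ k ∈ G.inner (n + 1), powerCoeff G.knot (n + 1) q k * ψ k
      = ∑ k ∈ T, powerCoeff G.knot (n + 1) q k * ψ k := by
        refine finsum_mem_eq_sum_of_inter_support_eq _ (Set.ext fun k => ?_)
        refine and_congr_left fun hne => ⟨fun _ => ?_, fun _ => hGin k⟩
        have hne' : ψ k ≠ 0 := right_ne_zero_of_mul hne
        rw [hψS] at hne'
        obtain ⟨l, hl, hlk⟩ := Finset.exists_ne_zero_of_sum_ne_zero hne'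
        exact Finset.mem_biUnion.mpr ⟨l, hl, hK l k (left_ne_zero_of_mul hlk)⟩
    _ = ∑ l ∈ S, powerCoeff x (n + 1) q l * bspline x (n + 1) l t := by
        simp_rw [hψS, Finset.mul_sum]
        rw [Finset.sum_comm]
        refine Finset.sum_congr rfl fun l hl => ?_
        rw [hrow l hl, Finset.sum_mul]
        refine Finset.sum_congr rfl fun k _ => ?_
        change powerCoeff (fun i => x (2 * i)) (n + 1) q k * _ = _
        ring
    _ = t ^ q := hfine

/-- The sequence that agrees with `x` on `{a, …, b}` and has slope `1` elsewhere. -/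
def extendKnots (x : ℤ → ℝ) (a b i : ℤ) : ℝ :=
  x (max a (min i b)) + ((i - max a (min i b) : ℤ) : ℝ)

theorem extendKnots_eq {x : ℤ → ℝ} {a b i : ℤ} (h1 : a ≤ i) (h2 : i ≤ b) :
    extendKnots x a b i = x i := by
  simp [extendKnots, h1, h2]

theorem strictMono_extendKnots {x : ℤ → ℝ} {a b : ℤ} (hab : a ≤ b)
    (hx : StrictMonoOn x (Set.Icc a b)) : StrictMono (extendKnots x a b) := by
  intro i j hij
  unfold extendKnots
  have hi : max a (min i b) ∈ Set.Icc a b := ⟨by omega, by omega⟩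
  have hj : max a (min j b) ∈ Set.Icc a b := ⟨by omega, by omega⟩
  rcases eq_or_lt_of_le (show max a (min i b) ≤ max a (min j b) by omega) with h | h
  · rw [h]
    have : i - max a (min j b) < j - max a (min j b) := by omega
    have : ((i - max a (min j b) : ℤ) : ℝ) < ((j - max a (min j b) : ℤ) : ℝ) := by
      exact_mod_cast this
    linarith
  · have h1 := hx hi hj h
    have : i - max a (min i b) ≤ j - max a (min j b) := by omega
    have : ((i - max a (min i b) : ℤ) : ℝ) ≤ ((j - max a (min j b) : ℤ) : ℝ) := by
      exact_mod_cast this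
    linarith

/-- Replacing the knots outside the coarse support by a strictly increasing continuation changes
neither the coarse B-spline, nor column `k`, nor the fine B-splines that this column uses. -/
theorem refinement {n : ℕ} {fine coarse : KnotGrid} (hnest : TwoNested fine coarse) {k : ℤ}
    (hk : k ∈ coarse.inner (n + 1)) (t : ℝ) :
    bspline coarse.knot (n + 1) k t
      = ∑ᶠ l : ℤ, refinementMatrix fine.knot (n + 1) l k * bspline fine.knot (n + 1) l t := by
  have hl := (hnest _ hk.1).1
  have hr := (hnest _ hk.2).1
  have hle : 2 * leftIdx (n + 1) k ≤ 2 * rightIdx (n + 1) k := by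
    simp only [leftIdx, rightIdx]; omega
  have hy := strictMono_extendKnots hle (fine.strictMonoOn_Icc hl hr)
  have hxy : ∀ i, 2 * leftIdx (n + 1) k ≤ i → i ≤ 2 * rightIdx (n + 1) k →
      fine.knot i = extendKnots fine.knot (2 * leftIdx (n + 1) k) (2 * rightIdx (n + 1) k) i :=
    fun i h1 h2 => (extendKnots_eq h1 h2).symm
  set y := extendKnots fine.knot (2 * leftIdx (n + 1) k) (2 * rightIdx (n + 1) k)
  rw [bspline_congr (y := fun i => y (2 * i)) (fun i h1 h2 => by
      rw [hnest.knot_eq hk h1 h2, hxy _ (by omega) (by omega)]) t, refinement_of_strictMono hy]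
  refine finsum_congr fun l => ?_
  obtain ⟨h1, h2⟩ := refinementMatrix_congr (by omega) hxy l
  rw [← h1]
  by_cases hne : refinementMatrix fine.knot (n + 1) l k = 0
  · rw [hne, zero_mul, zero_mul]
  · have h3 := h2 hne
    rw [bspline_congr (fun i h4 h5 => hxy i ?_ ?_) t] <;>
    · simp only [leftIdx, rightIdx] at *; omega

theorem coarseCoeff_eq_powerCoeff {n q : ℕ} {fine coarse : KnotGrid}
    (hnest : TwoNested fine coarse) (hq : q ≤ n) {a : ℤ → ℝ} (ha : IsPowerCoeffs fine (n + 1) q a)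
    (hne : (fine.interior (n + 1)).Nonempty) {k : ℤ} (hk : k ∈ coarse.inner (n + 1)) :
    coarseCoeff fine.knot (n + 1) a k = powerCoeff coarse.knot (n + 1) q k := by
  rw [coarseCoeff_eq (powerFunctional n q) (by omega) fine.ordConnected fine.strictMonoOn
    (fun l h1 h2 => KnotGrid.eq_powerCoeff hne hq ha ⟨h1, h2⟩) (hnest _ hk.1).1 (hnest _ hk.2).1,
    powerCoeff]
  refine congrArg _ (knotPoly_congr fun i hi => ?_)
  rw [Finset.mem_Ioc] at hi
  exact (hnest.knot_eq hk hi.1.le (by omega)).symm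

end BSplineLifting

open BSplineLifting
theorem mainTheorem1 (p : ℕ) (hp : 1 ≤ p) (fine coarse : KnotGrid)
    (hnest : TwoNested fine coarse) :
    -- power coefficients exist at the fine scale
    (∀ q < p, ∃ a : ℤ → ℝ, IsPowerCoeffs fine p q a) ∧
    -- the factors that the scheme divides by are nonzero
    (∀ k ∈ coarse.inner p,
      (∀ s ≤ numU p, evenFactor fine.knot p s k ≠ 0) ∧
      (k + 1 ∈ coarse.inner p → ∀ i < numR p + numU p, oddFactor fine.knot p i k ≠ 0)) ∧
    -- fine power coefficients are mapped to the coarse power coefficients and zero details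
    (∀ q < p, ∀ a : ℤ → ℝ, IsPowerCoeffs fine p q a →
      IsPowerCoeffs coarse p q (coarseCoeff fine.knot p a) ∧
      ((coarse.interior p).Nonempty → ∀ b : ℤ → ℝ, IsPowerCoeffs coarse p q b →
        ∀ k ∈ coarse.inner p, coarseCoeff fine.knot p a k = b k) ∧
      (∀ k ∈ coarse.inner p, k + 1 ∈ coarse.inner p → detailCoeff fine.knot p a k = 0)) ∧
    -- the B-splines solve the refinement equation of the scheme
    (∀ k ∈ coarse.inner p, ∀ t : ℝ,
      bspline coarse.knot p k t =
        ∑ᶠ l : ℤ, refinementMatrix fine.knot p l k * bspline fine.knot p l t) ∧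
    -- and they are its only solution with the supports and the power coefficients of B-splines
    (∀ F f : ℤ → ℝ → ℝ,
      (∀ l ∈ fine.inner p, ∀ t ∈ coarse.interior p, t ∉ fine.supp p l → F l t = 0) →
      (∀ q < p, ∀ a : ℤ → ℝ, IsPowerCoeffs fine p q a →
        ∀ t ∈ coarse.interior p, ∑ᶠ l ∈ fine.inner p, a l * F l t = t ^ q) →
      (∀ k ∈ coarse.inner p, ∀ t ∈ coarse.interior p,
        f k t = ∑ᶠ l : ℤ, refinementMatrix fine.knot p l k * F l t) →
      ∀ k ∈ coarse.inner p, ∀ t ∈ coarse.interior p, f k t = bspline coarse.knot p k t) := by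
  obtain ⟨n, rfl⟩ : ∃ n, p = n + 1 := ⟨p - 1, by omega⟩
  have h1 := numR_le_one (n + 1)
  have h2 := par_nonneg (n + 1)
  have h3 := par_le_one (n + 1)
  have h4 := half_add_par (n + 1)
  have hmono : ∀ k ∈ coarse.inner (n + 1), StrictMonoOn fine.knot
      (Set.Icc (2 * leftIdx (n + 1) k) (2 * rightIdx (n + 1) k)) := fun k hk =>
    fine.strictMonoOn_Icc (hnest _ hk.1).1 (hnest _ hk.2).1
  refine ⟨fun q hq => ⟨_, fine.isPowerCoeffs_powerCoeff (Nat.lt_succ_iff.mp hq)⟩,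
    fun k hk => ⟨fun s hs => ?_, fun _ i hi => ?_⟩, fun q hq a ha => ⟨?_, ?_, ?_⟩,
    fun k hk t => refinement hnest hk t, fun F f hF hsum hf k hk t ht => ?_⟩
  · refine evenFactor_ne_zero hs ((hmono k hk).mono (Set.Icc_subset_Icc ?_ ?_)) <;>
    · simp only [leftIdx, rightIdx_eq]; omega
  · refine oddFactor_ne_zero hi ((hmono k hk).mono (Set.Icc_subset_Icc ?_ ?_)) <;>
    · simp only [leftIdx, rightIdx_eq]; omega
  · intro t ht
    have hne : (fine.interior (n + 1)).Nonempty := ⟨t, hnest.interior_subset n ht⟩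
    rw [← coarse.isPowerCoeffs_powerCoeff (Nat.lt_succ_iff.mp hq) t ht]
    exact finsum_mem_congr rfl fun k hk => by
      rw [coarseCoeff_eq_powerCoeff hnest (Nat.lt_succ_iff.mp hq) ha hne hk]
  · intro hne b hb k hk
    rw [coarseCoeff_eq_powerCoeff hnest (Nat.lt_succ_iff.mp hq) ha
      (hne.mono (hnest.interior_subset n)) hk,
      KnotGrid.eq_powerCoeff hne (Nat.lt_succ_iff.mp hq) hb hk]
  · intro k hk hk'
    have hl := (hnest _ hk.1).1
    have hr := (hnest _ hk'.2).1
    have hne : (fine.interior (n + 1)).Nonempty := by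
      -- The coarse interior may be empty here, but `2 l_k` and `2 r_{k+1}` are `2 p + 2` apart, so
      -- the fine grid has the `2 p` consecutive indices of an interior window, here the one
      -- starting at `2 l_k`. This makes the fine power coefficients unique.
      refine KnotGrid.interior_nonempty (i := 2 * leftIdx (n + 1) k + n) ?_ ?_ <;>
      · refine fine.ordConnected.out hl hr ⟨?_, ?_⟩ <;>
        · simp only [leftIdx, rightIdx]; omega
    exact detailCoeff_eq_zero (powerFunctional n q) hp fine.ordConnected fine.strictMonoOn
      (fun l h1 h2 => KnotGrid.eq_powerCoeff hne (Nat.lt_succ_iff.mp hq) ha ⟨h1, h2⟩) hl hr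
  · rw [hf k hk t ht, refinement hnest hk t]
    refine finsum_congr fun l => ?_
    by_cases hne : refinementMatrix fine.knot (n + 1) l k = 0
    · rw [hne, zero_mul, zero_mul]
    · have h := (refinementMatrix_congr (x := fine.knot) (y := fine.knot) hp
        (fun _ _ _ => rfl) l).2 hne
      -- Nonzero entries of column `k` sit at inner fine indices, and there the reproduction of
      -- powers forces `F l t` to be the value of the fine B-spline.
      rw [KnotGrid.eq_bspline (v := fun l => F l t) (hnest.interior_subset n ht)
        (fun l hl hs => hF l hl t ht hs)
        (fun q hq => hsum q (Nat.lt_succ_iff.mpr hq) _ (fine.isPowerCoeffs_powerCoeff hq) t ht)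
        (hnest.mem_inner hk h.1 h.2)]
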